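/- For complex $v,\tau$ with $\operatorname{Im}\tau>0$ put $$\theta_1(v,\tau)=\sum_{n\in\mathbb Z}e^{\pi i\tau(n+\frac12)^2}e^{2\pi i(n+\frac12)v},\qquad \theta_3(v,\tau)=\sum_{n\in\mathbb Z}e^{\pi i\tau n^2}e^{2\pi i n v}.$$ For $\lambda>0$ let $G_\lambda(z)=e^{-\pi\lambda z^2}$ and let $K_\lambda$ be the entire function $$K_\lambda(z)=\frac{\cos\pi z}{\pi}\sum_{n\in\mathbb Z}(-1)^{n+1}\frac{G_\lambda(n+\frac12)}{z-n-\frac12}$$ (extended over its removable singularities, so that $K_\lambda(n+\frac12)=G_\lambda(n+\frac12)$ for $n\in\mathbb Z$). For an integer $N\ge 0$ define on $\mathbb R/\mathbb Z$ $$k_{\lambda,N}(x)=\lambda^{\frac12}\sum_{n\in\mathbb Z}K_{(2N+2)^{-2}\lambda}\bigl((2N+2)(x+n)\bigr).$$ Let $\lambda>0$ and let $N\ge0$ be an integer. Then $k_{\lambda,N}$ is a trigonometric polynomial of degree at most $N$ on $\mathbb R/\mathbb Z$. Moreover, for every (complex valued) trigonometric polynomial $p(x)=\sum_{n=-N}^{N}c_n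 e^{2\pi i n x}$ of degree at most $N$ on $\mathbb R/\mathbb Z$, $$\int_{-\frac12}^{\frac12}\theta_1\bigl(u,i\lambda^{-1}(2N+2)^2\bigr)\,du\le\int_{\mathbb R/\mathbb Z}\bigl|\theta_3(x,i\lambda^{-1})-p(x)\bigr|\,dx,$$ and equality holds if and only if $p=k_{\lambda,N}$. -/

import Mathlib

open scoped ComplexOrder

/-- The theta function `θ₁(v, τ) = ∑_{n ∈ ℤ} q^{(n + 1/2)²} e((n + 1/2) v)`, where `q = e^{π i τ}`
(so that `q^s` is read as `e^{π i τ s}`) and `e(z) = e^{2 π i z}`. -/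
noncomputable def thetaOne (v τ : ℂ) : ℂ :=
  ∑' n : ℤ, Complex.exp (Real.pi * Complex.I * τ * ((n : ℂ) + 1 / 2) ^ 2) *
    Complex.exp (2 * Real.pi * Complex.I * (((n : ℂ) + 1 / 2) * v))

/-- The theta function `θ₃(v, τ) = ∑_{n ∈ ℤ} q^{n²} e(n v)`: this is Mathlib's two-variable Jacobi
theta function. -/
noncomputable def thetaThree (v τ : ℂ) : ℂ := jacobiTheta₂ v τ

/-- The Gaussian `G_λ(z) = e^{-π λ z²}`. -/
noncomputable def gaussianG (lam : ℝ) (z : ℂ) : ℂ :=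
  Complex.exp (-Real.pi * lam * z ^ 2)

open scoped Classical in
/-- The entire function
`K_λ(z) = (cos π z / π) ∑_{n ∈ ℤ} (-1)^{n+1} G_λ(n + 1/2) / (z - n - 1/2)`.
At the points of `ℤ + 1/2` the formula has removable singularities; there `K_λ` takes its limit
value, which is the value of `G_λ`. -/
noncomputable def entireK (lam : ℝ) (z : ℂ) : ℂ :=
  if ∃ m : ℤ, z = (m : ℂ) + 1 / 2 then gaussianG lam z
  else (Complex.cos (Real.pi * z) / Real.pi) *
    ∑' n : ℤ, (-1 : ℂ) ^ (n + 1) * gaussianG lam ((n : ℂ) + 1 / 2) / (z - n - 1 / 2)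

/-- The function `x ↦ λ^{1/2} ∑_{n ∈ ℤ} K_{(2N+2)⁻² λ}((2N+2)(x + n))` of a real variable. -/
noncomputable def kSum (lam : ℝ) (N : ℕ) (x : ℝ) : ℂ :=
  (Real.sqrt lam : ℂ) *
    ∑' n : ℤ, entireK (lam / (2 * N + 2) ^ 2) ((2 * (N : ℂ) + 2) * ((x : ℂ) + n))

theorem kSum_periodic (lam : ℝ) (N : ℕ) : Function.Periodic (kSum lam N) 1 := by
  intro x
  unfold kSum
  congr 1
  rw [← (Equiv.addRight (1 : ℤ)).tsum_eq
    (fun n : ℤ => entireK (lam / (2 * N + 2) ^ 2) ((2 * (N : ℂ) + 2) * ((x : ℂ) + n)))]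
  refine tsum_congr fun n => ?_
  congr 2
  simp only [Equiv.coe_addRight]
  push_cast
  ring

theorem thetaThree_periodic (τ : ℂ) :
    Function.Periodic (fun x : ℝ => thetaThree (x : ℂ) τ) 1 := by
  intro x
  simp only [thetaThree]
  push_cast
  exact jacobiTheta₂_add_left _ _

/-- `x ↦ θ₃(x, τ)` as a function on `ℝ/ℤ`. -/
noncomputable def thetaThreeCircle (τ : ℂ) : UnitAddCircle → ℂ :=
  (thetaThree_periodic τ).lift

/-- `k_{λ,N}` as a function on `ℝ/ℤ`. -/
noncomputable def kCircle (lam : ℝ) (N : ℕ) : UnitAddCircle → ℂ :=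
  (kSum_periodic lam N).lift

/-- `p` is a (complex valued) trigonometric polynomial of degree at most `N` on `ℝ/ℤ`:
`p(x) = ∑_{n=-N}^{N} c_n e(n x)`. -/
def IsTrigPolyOfDegreeLE (N : ℕ) (p : UnitAddCircle → ℂ) : Prop :=
  ∃ c : ℤ → ℂ, ∀ x, p x = ∑ n ∈ Finset.Icc (-(N : ℤ)) N, c n * fourier n x

/-! Write M = 2N+2. The sum of (-1)^i f(x + i/M) over 0 ≤ i < M annihilates every frequency of f
except the odd multiples of N+1. Applied to θ₃ - p it removes p and leaves M θ₁(Mx, iM²/λ), whatever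
p is. Integrating over one cell of length 1/M and using Re((-1)^i z) ≤ |z| gives the lower bound.
Equality forces (-1)^i (θ₃ - p) to be real and nonnegative on the i-th cell; at a common endpoint of
two cells the two signs conflict, so p interpolates θ₃ at 2N+1 nodes and is thereby determined.

It remains to find an interpolant whose error has the sign of cos(πMx). For `interpPoly`, whose
coefficients are aliased Gaussians, `thetaThree_sub_interpPoly` factors the error as 2cos(πMx) S(x),
where S has alternating Gaussian tails as coefficients. Completing the square (`altTail_abs_eq`)
writes these as the coefficients of θ₃ times values of `mixedExp`, the Fourier transform of
`mixedKernel`; hence S is an integral of translates of θ₃ > 0 against `mixedKernel`. That density is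
positive because cosh(πs) times it is an integral of `halfTheta`, half of θ₁, against a hyperbolic
cosine (`cosh_mul_mixedKernel`), and `halfTheta_pos` holds on |u| < 1/2: by domination by the first
term if T ≥ 1, and by the same after Poisson summation if T ≤ 1.

Finally `kSum_eq_interpPoly` identifies k with the interpolant: summing the partial fractions of K
over translates produces cotangents, cos(πMx) turns these into Dirichlet kernels, and Poisson
summation returns the aliased coefficients. -/

open MeasureTheory FourierTransform

/-! ### Exponentials and Gaussian summability -/

/-- The character `x ↦ e^{2πix}`. -/
noncomputable def expTwoPi (x : ℝ) : ℂ := Complex.exp (2 * Real.pi * Complex.I * x)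

theorem norm_expTwoPi (x : ℝ) : ‖expTwoPi x‖ = 1 := by
  have : (2 * Real.pi * Complex.I * x : ℂ) = ((2 * Real.pi * x : ℝ) : ℂ) * Complex.I := by
    push_cast; ring
  rw [expTwoPi, this, Complex.norm_exp_ofReal_mul_I]

theorem expTwoPi_add (x y : ℝ) : expTwoPi (x + y) = expTwoPi x * expTwoPi y := by
  rw [expTwoPi, expTwoPi, expTwoPi, ← Complex.exp_add]
  push_cast; ring_nf

theorem expTwoPi_zero : expTwoPi 0 = 1 := by simp [expTwoPi]

theorem expTwoPi_neg (x : ℝ) : expTwoPi (-x) = (expTwoPi x)⁻¹ := by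
  rw [expTwoPi, expTwoPi, ← Complex.exp_neg]
  push_cast; ring_nf

theorem expTwoPi_ne_zero (x : ℝ) : expTwoPi x ≠ 0 := Complex.exp_ne_zero _

theorem expTwoPi_int (n : ℤ) : expTwoPi n = 1 := by
  rw [expTwoPi, Complex.exp_eq_one_iff]
  exact ⟨n, by push_cast; ring⟩

theorem expTwoPi_half : expTwoPi (1 / 2) = -1 := by
  rw [expTwoPi, ← Complex.exp_pi_mul_I]
  push_cast; ring_nf

theorem expTwoPi_int_mul (n : ℤ) (x : ℝ) : expTwoPi (n * x) = expTwoPi x ^ n := by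
  rw [expTwoPi, expTwoPi, ← Complex.exp_int_mul]
  push_cast; ring_nf

theorem expTwoPi_nat_mul (n : ℕ) (x : ℝ) : expTwoPi (n * x) = expTwoPi x ^ n := by
  exact_mod_cast expTwoPi_int_mul n x

theorem expTwoPi_int_div_two (n : ℤ) : expTwoPi (n / 2) = (-1) ^ n := by
  rw [← expTwoPi_half, ← expTwoPi_int_mul]; ring_nf

theorem expTwoPi_add_neg (x : ℝ) :
    expTwoPi x + expTwoPi (-x) = 2 * (Real.cos (2 * Real.pi * x) : ℂ) := by
  rw [expTwoPi, expTwoPi, Complex.ofReal_cos, Complex.two_cos]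
  push_cast; ring_nf

theorem expTwoPi_sub_neg (x : ℝ) :
    expTwoPi x - expTwoPi (-x) = 2 * Complex.I * (Real.sin (2 * Real.pi * x) : ℂ) := by
  have h := Complex.two_sin (2 * Real.pi * x)
  rw [expTwoPi, expTwoPi, Complex.ofReal_sin]
  push_cast
  rw [show ∀ z : ℂ, 2 * Complex.I * z = Complex.I * (2 * z) from fun z => by ring, h,
    show ∀ z : ℂ, Complex.I * (z * Complex.I) = -z from
      fun z => by linear_combination z * Complex.I_mul_I]
  ring_nf

@[fun_prop]
theorem continuous_expTwoPi : Continuous expTwoPi := by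
  unfold expTwoPi; fun_prop

theorem summable_gaussian_shift {t : ℝ} (ht : 0 < t) (a : ℝ) :
    Summable fun n : ℤ => Real.exp (-Real.pi * t * (n + a) ^ 2) := by
  refine (HurwitzZeta.hasSum_int_evenKernel a ht).summable.congr fun n => ?_
  ring_nf

theorem summable_ofReal_mul_expTwoPi {ι : Type*} {a : ι → ℝ} (ha : Summable a) (h0 : ∀ i, 0 ≤ a i)
    (f : ι → ℝ) : Summable fun i => (a i : ℂ) * expTwoPi (f i) := by
  refine Summable.of_norm_bounded ha fun i => ?_
  rw [norm_mul, norm_expTwoPi, mul_one, Complex.norm_real, Real.norm_of_nonneg (h0 i)]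

/-! ### Poisson summation and the two forms of θ₃ -/

/-- Poisson summation for the Gaussian with half-integral characteristic. -/
theorem tsum_gaussian_half_int {T : ℝ} (hT : 0 < T) (u : ℝ) :
    ∑' n : ℤ, (Real.exp (-Real.pi * T * (n + 1 / 2) ^ 2) : ℂ) * expTwoPi ((n + 1 / 2) * u) =
      ((1 / Real.sqrt T : ℝ) : ℂ) *
        ∑' n : ℤ, (-1 : ℂ) ^ n * (Real.exp (-Real.pi * (1 / T) * (n + u) ^ 2) : ℂ) := by
  have hT' : (T : ℂ) ≠ 0 := by exact_mod_cast hT.ne'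
  -- The linear coefficient comes from expanding (n + 1/2)² and (n + 1/2)u; the constant terms are
  -- collected in `C`.
  have key := Complex.tsum_exp_neg_quadratic (a := (T : ℂ)) (by simpa using hT)
    (-T / 2 + Complex.I * u)
  have hc : (1 / (T : ℂ) ^ (1 / 2 : ℂ)) = ((1 / Real.sqrt T : ℝ) : ℂ) := by
    rw [Real.sqrt_eq_rpow]
    push_cast
    rw [Complex.ofReal_cpow hT.le]
    push_cast; rfl
  rw [hc] at key
  set C : ℂ := Complex.exp (-Real.pi * T / 4 + Real.pi * Complex.I * u)
  have h1 : ∀ n : ℤ, (Real.exp (-Real.pi * T * (n + 1 / 2) ^ 2) : ℂ) * expTwoPi ((n + 1 / 2) * u) =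
      C * Complex.exp (-Real.pi * T * n ^ 2 + 2 * Real.pi * (-T / 2 + Complex.I * u) * n) := by
    intro n
    rw [expTwoPi, Complex.ofReal_exp, ← Complex.exp_add, ← Complex.exp_add]
    push_cast; ring_nf
  simp_rw [h1]
  rw [tsum_mul_left, key, mul_left_comm, ← tsum_mul_left]
  congr 1
  rw [← (Equiv.neg ℤ).tsum_eq]
  refine tsum_congr fun n => ?_
  rw [← expTwoPi_int_div_two, expTwoPi, Complex.ofReal_exp, ← Complex.exp_add, ← Complex.exp_add]
  -- After n ↦ -n the two sides carry the phases e^{-πin} and e^{πin}, which differ by this factor.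
  have h2 : Complex.exp (2 * Real.pi * Complex.I * n) = 1 := by
    have := expTwoPi_int n
    rw [expTwoPi] at this; exact_mod_cast this
  rw [Equiv.neg_apply, ← mul_one (Complex.exp _), ← h2, ← Complex.exp_add]
  congr 1
  push_cast
  field_simp
  ring_nf
  have h3 : Complex.I ^ 3 = -Complex.I := by rw [pow_succ, Complex.I_sq]; ring
  have h4 : Complex.I ^ 4 = 1 := by rw [show 4 = 2 * 2 from rfl, pow_mul, Complex.I_sq]; norm_num
  simp only [h3, h4, Complex.I_sq]
  ring

/-- `θ₃(x, i/λ)` as a cosine series. -/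
theorem hasSum_thetaThree {lam : ℝ} (hlam : 0 < lam) (x : ℝ) :
    HasSum (fun n : ℤ => (Real.exp (-Real.pi * (1 / lam) * n ^ 2) : ℂ) * expTwoPi (n * x))
      (thetaThree x (Complex.I / lam)) := by
  have h := HurwitzZeta.hasSum_int_cosKernel x (t := 1 / lam) (by positivity)
  rw [HurwitzZeta.cosKernel_def] at h
  have e : Complex.I * ((1 / lam : ℝ) : ℂ) = Complex.I / lam := by push_cast; ring
  rw [e] at h
  rw [thetaThree]
  convert h using 2 with n
  rw [expTwoPi, mul_comm]
  congr 1
  · norm_num [mul_comm, mul_assoc, mul_left_comm]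
  · push_cast; ring_nf

/-- `θ₃(x, i/λ)` as a periodised Gaussian. -/
theorem thetaThree_eq_periodized {lam : ℝ} (hlam : 0 < lam) (x : ℝ) :
    thetaThree x (Complex.I / lam) =
      ((Real.sqrt lam * ∑' n : ℤ, Real.exp (-Real.pi * lam * (n + x) ^ 2) : ℝ) : ℂ) := by
  have h := (HurwitzZeta.hasSum_int_evenKernel x hlam).tsum_eq
  have e : Complex.I * ((1 / lam : ℝ) : ℂ) = Complex.I / lam := by push_cast; ring
  rw [thetaThree, ← e, ← HurwitzZeta.cosKernel_def]
  congr 1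
  have hs : (0 : ℝ) < Real.sqrt lam := Real.sqrt_pos.2 hlam
  have h3 := HurwitzZeta.evenKernel_functional_equation x lam
  rw [← Real.sqrt_eq_rpow] at h3
  rw [tsum_congr (fun n : ℤ => show Real.exp (-Real.pi * lam * (n + x) ^ 2) =
    Real.exp (-Real.pi * (n + x) ^ 2 * lam) by ring_nf), h, h3]
  field_simp

theorem thetaThree_pos {lam : ℝ} (hlam : 0 < lam) (x : ℝ) :
    0 < (thetaThree x (Complex.I / lam)).re := by
  rw [thetaThree_eq_periodized hlam, Complex.ofReal_re]
  refine mul_pos (Real.sqrt_pos.2 hlam) ?_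
  exact (summable_gaussian_shift hlam x).tsum_pos (fun _ => (Real.exp_pos _).le) 0 (Real.exp_pos _)

/-! ### Positivity of θ₁ on |u| < 1/2 -/

/-- A series dominated by a geometric one with small ratio has the sign of its first term. -/
theorem tsum_pos_of_abs_le_geometric {c : ℕ → ℝ} (h0 : 0 < c 0)
    (hc : ∀ n, |c n| ≤ c 0 * (1 / 3) ^ n) : 0 < ∑' n, c n := by
  have hg : HasSum (fun n : ℕ => c 0 * (1 / 3) ^ n) (c 0 * (3 / 2)) := by
    have := (hasSum_geometric_of_lt_one (r := 1 / 3) (by norm_num) (by norm_num)).mul_left (c 0)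
    rwa [show (1 - 1 / 3 : ℝ)⁻¹ = 3 / 2 by norm_num] at this
  have hs : Summable c := Summable.of_norm_bounded hg.summable hc
  have hg1 := hg.summable.tsum_eq_zero_add
  rw [hs.tsum_eq_zero_add]
  have h1 : ‖∑' n, c (n + 1)‖ ≤ ∑' n, c 0 * (1 / 3) ^ (n + 1) :=
    tsum_of_norm_bounded ((summable_nat_add_iff 1).2 hg.summable).hasSum fun n => hc (n + 1)
  rw [hg.tsum_eq, pow_zero, mul_one] at hg1
  have := (abs_le.1 h1).1
  linarith

/-- Induction through (2n+3)w = (2n+1)w + 2w, where sin 2w supplies a factor cos w. Keeping that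
factor matters: the leading term of the theta series degenerates as |u| → 1/2, so |cos| ≤ 1 would
not be enough. -/
theorem abs_cos_odd_mul_le (n : ℕ) (w : ℝ) :
    |Real.cos ((2 * n + 1) * w)| ≤ (2 * n + 1) * |Real.cos w| := by
  induction n with
  | zero => simp
  | succ n ih =>
    have h : ((2 * ((n + 1 : ℕ) : ℝ) + 1) * w) = (2 * n + 1) * w + 2 * w := by push_cast; ring
    rw [h, Real.cos_add, Real.sin_two_mul]
    have h1 : |Real.cos ((2 * n + 1) * w) * Real.cos (2 * w)| ≤ (2 * n + 1) * |Real.cos w| := by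
      rw [abs_mul]
      exact (mul_le_of_le_one_right (abs_nonneg _) (Real.abs_cos_le_one _)).trans ih
    have h2 : |Real.sin ((2 * n + 1) * w) * (2 * Real.sin w * Real.cos w)| ≤ 2 * |Real.cos w| := by
      rw [abs_mul, abs_mul, abs_mul, abs_two]
      have a1 := Real.abs_sin_le_one ((2 * n + 1) * w)
      have a2 := Real.abs_sin_le_one w
      have : |Real.sin ((2 * n + 1) * w)| * |Real.sin w| ≤ 1 := mul_le_one₀ a1 (abs_nonneg _) a2
      nlinarith [abs_nonneg (Real.cos w)]
    refine (norm_sub_le (_ : ℝ) _).trans ?_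
    rw [Real.norm_eq_abs, Real.norm_eq_abs]
    push_cast; linarith

/-- Bernoulli gives 2n+1 ≤ 3^n, and e^{-π} ≤ 1/9. -/
theorem two_mul_add_one_mul_exp_le {n : ℕ} {s : ℝ} (hs : Real.pi * n ≤ s) :
    (2 * n + 1) * Real.exp (-s) ≤ (1 / 3) ^ n := by
  have h1 : (2 * n + 1 : ℝ) ≤ 3 ^ n := by
    have := one_add_mul_le_pow (a := (2 : ℝ)) (by norm_num) n
    norm_num at this; linarith
  have h2 : Real.exp (-s) ≤ (1 / 9) ^ n := by
    have h3 : Real.exp (-Real.pi) ≤ 1 / 9 := by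
      rw [Real.exp_neg, one_div]
      refine inv_anti₀ (by norm_num) ?_
      have : Real.exp 3 ≤ Real.exp Real.pi := Real.exp_le_exp.2 Real.pi_gt_three.le
      have h4 : Real.exp 3 = Real.exp 1 ^ 3 := by rw [← Real.exp_nat_mul]; norm_num
      have := Real.exp_one_gt_d9
      have : (2.7 : ℝ) ^ 3 ≤ Real.exp 1 ^ 3 := by gcongr; linarith
      norm_num at this; linarith
    calc Real.exp (-s) ≤ Real.exp (n * -Real.pi) := Real.exp_le_exp.2 (by linarith)
      _ = Real.exp (-Real.pi) ^ n := Real.exp_nat_mul _ _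
      _ ≤ _ := by gcongr
  calc _ ≤ (3 : ℝ) ^ n * (1 / 9) ^ n := by gcongr
    _ = _ := by rw [← mul_pow]; norm_num

/-- The half of the theta series with half-integral characteristic running over `n ≥ 0`. -/
noncomputable def halfTheta (T u : ℝ) : ℝ :=
  ∑' n : ℕ, Real.exp (-Real.pi * T * (n + 1 / 2) ^ 2) * Real.cos (2 * Real.pi * ((n + 1 / 2) * u))

theorem summable_gaussian_nat {T : ℝ} (hT : 0 < T) :
    Summable fun n : ℕ => Real.exp (-Real.pi * T * (n + 1 / 2) ^ 2) :=
  (summable_gaussian_shift hT (1 / 2)).comp_injective (i := fun n : ℕ => (n : ℤ))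
    Nat.cast_injective

theorem halfTheta_neg (T u : ℝ) : halfTheta T (-u) = halfTheta T u := by
  unfold halfTheta
  refine tsum_congr fun n => ?_
  rw [mul_neg, mul_neg, Real.cos_neg]

theorem two_mul_halfTheta {T : ℝ} (hT : 0 < T) (u : ℝ) :
    ((2 * halfTheta T u : ℝ) : ℂ) =
      ∑' n : ℤ, (Real.exp (-Real.pi * T * (n + 1 / 2) ^ 2) : ℂ) * expTwoPi ((n + 1 / 2) * u) := by
  have hs := summable_ofReal_mul_expTwoPi (summable_gaussian_shift hT (1 / 2))
    (fun _ => (Real.exp_pos _).le) (fun n => (n + 1 / 2) * u)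
  rw [← tsum_nat_add_neg_add_one hs, halfTheta, ← tsum_mul_left, Complex.ofReal_tsum]
  refine tsum_congr fun n => ?_
  have h1 : ((-((n : ℤ) + 1) : ℤ) : ℝ) + 1 / 2 = -(n + 1 / 2) := by push_cast; ring
  rw [h1, neg_sq, neg_mul (_ + _) u, Int.cast_natCast, ← mul_add, expTwoPi_add_neg]
  push_cast; ring

/-- The index k is paired with -(k+1) in the Poisson dual series; these carry opposite signs. -/
theorem two_mul_halfTheta_eq_alternating {T : ℝ} (hT : 0 < T) (u : ℝ) :
    2 * halfTheta T u = 1 / Real.sqrt T * ∑' k : ℕ, (-1) ^ k *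
      (Real.exp (-Real.pi * (1 / T) * (k + u) ^ 2) -
        Real.exp (-Real.pi * (1 / T) * (k + 1 - u) ^ 2)) := by
  have hT' : 0 < 1 / T := by positivity
  have hs : Summable fun n : ℤ =>
      (-1 : ℂ) ^ n * (Real.exp (-Real.pi * (1 / T) * (n + u) ^ 2) : ℂ) := by
    refine Summable.of_norm_bounded (summable_gaussian_shift hT' u) fun n => ?_
    rw [norm_mul, norm_zpow, norm_neg, norm_one, one_zpow, one_mul, Complex.norm_real,
      Real.norm_of_nonneg (Real.exp_pos _).le]
  have h := two_mul_halfTheta hT u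
  rw [tsum_gaussian_half_int hT, ← tsum_nat_add_neg_add_one hs] at h
  rw [← Complex.ofReal_inj, h, Complex.ofReal_mul, Complex.ofReal_tsum]
  congr 1
  refine tsum_congr fun n => ?_
  have h1 : (((-((n : ℤ) + 1) : ℤ) : ℝ) + u) ^ 2 = (n + 1 - u) ^ 2 := by push_cast; ring
  have h2 : (-1 : ℂ) ^ (-((n : ℤ) + 1)) = -(-1) ^ n := by
    rw [zpow_neg, ← inv_zpow, inv_neg, inv_one, zpow_add_one₀ (by norm_num), zpow_natCast]
    ring
  rw [h1, h2, Int.cast_natCast, zpow_natCast]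
  push_cast; ring

/-- Relative to the first term, the n-th is at most (2n+1)e^{-πTn(n+1)}, which decays geometrically.
-/
theorem halfTheta_pos_of_one_le {T : ℝ} (hT : 1 ≤ T) {u : ℝ} (h1 : |u| < 1 / 2) :
    0 < halfTheta T u := by
  have hcos : 0 < Real.cos (Real.pi * u) := by
    refine Real.cos_pos_of_mem_Ioo ?_
    have := abs_lt.1 h1
    constructor <;> nlinarith [Real.pi_pos]
  refine tsum_pos_of_abs_le_geometric ?_ fun n => ?_
  · have : 2 * Real.pi * (((0 : ℕ) + 1 / 2) * u) = Real.pi * u := by push_cast; ring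
    rw [this]; positivity
  · have e0 : 2 * Real.pi * (((0 : ℕ) + 1 / 2) * u) = Real.pi * u := by push_cast; ring
    have e1 : 2 * Real.pi * ((n + 1 / 2) * u) = (2 * n + 1) * (Real.pi * u) := by ring
    have e2 : Real.exp (-Real.pi * T * (n + 1 / 2) ^ 2) =
        Real.exp (-Real.pi * T * ((0 : ℕ) + 1 / 2) ^ 2) * Real.exp (-(Real.pi * T * (n * (n + 1)))) := by
      rw [← Real.exp_add]; push_cast; ring_nf
    rw [e0, e1, e2, abs_mul, abs_of_pos (by positivity)]
    have b1 := abs_cos_odd_mul_le n (Real.pi * u)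
    rw [abs_of_pos hcos] at b1
    have b2 : (2 * n + 1) * Real.exp (-(Real.pi * T * (n * (n + 1)))) ≤ (1 / 3) ^ n := by
      refine two_mul_add_one_mul_exp_le ?_
      rw [mul_assoc]
      refine mul_le_mul_of_nonneg_left ?_ Real.pi_pos.le
      have : (0 : ℝ) ≤ n := n.cast_nonneg
      nlinarith [mul_nonneg this this, mul_nonneg (mul_nonneg this this) (sub_nonneg.2 hT),
        mul_nonneg this (sub_nonneg.2 hT)]
    calc _ ≤ Real.exp (-Real.pi * T * ((0 : ℕ) + 1 / 2) ^ 2) *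
          Real.exp (-(Real.pi * T * (n * (n + 1)))) * ((2 * n + 1) * Real.cos (Real.pi * u)) := by
          gcongr
      _ = Real.exp (-Real.pi * T * ((0 : ℕ) + 1 / 2) ^ 2) * Real.cos (Real.pi * u) *
          ((2 * n + 1) * Real.exp (-(Real.pi * T * (n * (n + 1))))) := by ring
      _ ≤ _ := by gcongr

/-- In the dual series the parameter is t = 1/T ≥ 1. Each pair equals e^{-πt(k+u)²}(1 - y^{2k+1})
because (k+1-u)² - (k+u)² = (2k+1)(1-2u), and Bernoulli bounds the bracket by (2k+1)(1-y). The first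
term is again dominant; u ≥ 0 ensures k(k+2u) ≥ k. -/
theorem halfTheta_pos_of_le_one {T : ℝ} (hT : 0 < T) (hT1 : T ≤ 1) {u : ℝ} (h0 : 0 ≤ u)
    (h1 : u < 1 / 2) : 0 < halfTheta T u := by
  have key := two_mul_halfTheta_eq_alternating hT u
  have ht : 1 ≤ 1 / T := by rw [le_div_iff₀ hT]; linarith
  set t := 1 / T with ht_def
  set y := Real.exp (-Real.pi * t * (1 - 2 * u)) with hy
  have hy0 : 0 < y := Real.exp_pos _
  have hpi := Real.pi_pos
  have hpt : 0 < Real.pi * t := by positivity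
  have hy1 : y < 1 := by
    rw [hy, Real.exp_lt_one_iff]; nlinarith
  have hd : ∀ k : ℕ, Real.exp (-Real.pi * t * (k + u) ^ 2) -
      Real.exp (-Real.pi * t * (k + 1 - u) ^ 2) =
      Real.exp (-Real.pi * t * (k + u) ^ 2) * (1 - y ^ (2 * k + 1)) := by
    intro k
    rw [mul_sub, mul_one, hy, ← Real.exp_nat_mul, ← Real.exp_add]
    push_cast; ring_nf
  have hpos : 0 < ∑' k : ℕ, (-1 : ℝ) ^ k * (Real.exp (-Real.pi * t * (k + u) ^ 2) -
      Real.exp (-Real.pi * t * (k + 1 - u) ^ 2)) := by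
    simp_rw [hd]
    refine tsum_pos_of_abs_le_geometric ?_ fun k => ?_
    · have : 0 < 1 - y ^ (2 * 0 + 1) := by simpa using hy1
      simp only [pow_zero, one_mul]; positivity
    · have c1 : 1 - y ^ (2 * k + 1) ≤ (2 * k + 1) * (1 - y) := by
        have := one_add_mul_le_pow (a := y - 1) (by linarith) (2 * k + 1)
        rw [add_sub_cancel] at this; push_cast at this; linarith
      have c0 : 0 ≤ 1 - y ^ (2 * k + 1) := sub_nonneg.2 (pow_le_one₀ hy0.le hy1.le)
      have e2 : Real.exp (-Real.pi * t * (k + u) ^ 2) =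
          Real.exp (-Real.pi * t * ((0 : ℕ) + u) ^ 2) *
            Real.exp (-(Real.pi * t * (k * (k + 2 * u)))) := by
        rw [← Real.exp_add]; push_cast; ring_nf
      have b2 : (2 * k + 1) * Real.exp (-(Real.pi * t * (k * (k + 2 * u)))) ≤ (1 / 3) ^ k := by
        refine two_mul_add_one_mul_exp_le ?_
        rw [mul_assoc]
        refine mul_le_mul_of_nonneg_left ?_ Real.pi_pos.le
        rcases Nat.eq_zero_or_pos k with rfl | hk
        · simp
        have hk : (1 : ℝ) ≤ k := by exact_mod_cast hk
        have : (k : ℝ) ≤ k * (k + 2 * u) := by nlinarith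
        nlinarith
      rw [abs_mul, abs_pow, abs_neg, abs_one, one_pow, one_mul, e2,
        abs_of_nonneg (by positivity)]
      calc _ ≤ Real.exp (-Real.pi * t * ((0 : ℕ) + u) ^ 2) *
            Real.exp (-(Real.pi * t * (k * (k + 2 * u)))) * ((2 * k + 1) * (1 - y)) := by gcongr
        _ = Real.exp (-Real.pi * t * ((0 : ℕ) + u) ^ 2) * (1 - y) *
            ((2 * k + 1) * Real.exp (-(Real.pi * t * (k * (k + 2 * u))))) := by ring
        _ ≤ Real.exp (-Real.pi * t * ((0 : ℕ) + u) ^ 2) * (1 - y) * (1 / 3) ^ k := by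
            have : 0 ≤ 1 - y := by linarith
            gcongr
        _ = _ := by simp
  have : 0 < 1 / Real.sqrt T := by positivity
  have := mul_pos this hpos
  linarith

theorem halfTheta_pos {T : ℝ} (hT : 0 < T) {u : ℝ} (hu : |u| < 1 / 2) : 0 < halfTheta T u := by
  rcases le_total 1 T with h | h
  · exact halfTheta_pos_of_one_le h hu
  · rcases le_total 0 u with h0 | h0
    · exact halfTheta_pos_of_le_one hT h h0 (by rwa [abs_of_nonneg h0] at hu)
    · rw [← halfTheta_neg]
      exact halfTheta_pos_of_le_one hT h (by linarith) (by rwa [abs_of_nonpos h0] at hu)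

/-! ### The Cauchy kernel and its Fourier transform -/

/-- The Cauchy (Poisson) kernel `s ↦ b / (π (b² + s²))`. -/
noncomputable def cauchyKernel (b s : ℝ) : ℝ := b / (Real.pi * (b ^ 2 + s ^ 2))

theorem cauchyKernel_eq {b : ℝ} (hb : 0 < b) (s : ℝ) :
    cauchyKernel b s = Real.pi⁻¹ * b⁻¹ * (1 + (s / b) ^ 2)⁻¹ := by
  have := Real.pi_pos
  have : 0 < b ^ 2 + s ^ 2 := by positivity
  rw [cauchyKernel]
  field_simp

theorem cauchyKernel_nonneg {b : ℝ} (hb : 0 < b) (s : ℝ) : 0 ≤ cauchyKernel b s := by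
  have := Real.pi_pos
  unfold cauchyKernel; positivity

theorem continuous_cauchyKernel {b : ℝ} (hb : 0 < b) : Continuous (cauchyKernel b) := by
  have := Real.pi_pos
  unfold cauchyKernel
  refine Continuous.div (by fun_prop) (by fun_prop) fun s => ?_
  positivity

theorem integrable_cauchyKernel {b : ℝ} (hb : 0 < b) : Integrable (cauchyKernel b) := by
  simp_rw [funext (cauchyKernel_eq hb)]
  exact (integrable_inv_one_add_sq.comp_div hb.ne').const_mul _

theorem integral_cauchyKernel {b : ℝ} (hb : 0 < b) : ∫ s, cauchyKernel b s = 1 := by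
  simp_rw [cauchyKernel_eq hb]
  rw [integral_const_mul, Measure.integral_comp_div (fun s => (1 + s ^ 2)⁻¹) b,
    integral_univ_inv_one_add_sq, abs_of_pos hb, smul_eq_mul]
  have := Real.pi_pos
  field_simp

theorem integrable_exp_neg_mul_abs {c : ℝ} (hc : 0 < c) :
    Integrable fun x : ℝ => Complex.exp ((-(c * |x|) : ℝ) : ℂ) := by
  rw [← integrableOn_univ, ← Set.Iic_union_Ioi (a := (0 : ℝ)), integrableOn_union]
  constructor
  · refine (integrableOn_exp_mul_complex_Iic (a := (c : ℂ)) (by simpa using hc) 0).congr_fun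
      (fun x hx => ?_) measurableSet_Iic
    simp only [abs_of_nonpos (Set.mem_Iic.1 hx)]
    push_cast; ring_nf
  · refine (integrableOn_exp_mul_complex_Ioi (a := -(c : ℂ)) (by simpa using hc) 0).congr_fun
      (fun x hx => ?_) measurableSet_Ioi
    simp only [abs_of_pos (Set.mem_Ioi.1 hx)]
    push_cast; ring_nf

theorem fourier_exp_neg_mul_abs {b : ℝ} (hb : 0 < b) (s : ℝ) :
    𝓕 (fun x : ℝ => Complex.exp ((-(2 * Real.pi * b * |x|) : ℝ) : ℂ)) s = (cauchyKernel b s : ℂ) := by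
  have hpi := Real.pi_pos
  have hc : 0 < 2 * Real.pi * b := by positivity
  rw [Real.fourier_real_eq_integral_exp_smul]
  set a₁ : ℂ := 2 * Real.pi * (b - s * Complex.I) with ha₁
  set a₂ : ℂ := -(2 * Real.pi * (b + s * Complex.I)) with ha₂
  have r₁ : 0 < a₁.re := by simp [ha₁]; positivity
  have r₂ : a₂.re < 0 := by simp [ha₂]; positivity
  have e₁ : Set.EqOn (fun x : ℝ => Complex.exp (a₁ * x)) (fun x : ℝ =>
      Complex.exp (((-2 * Real.pi * x * s : ℝ) : ℂ) * Complex.I) •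
        Complex.exp ((-(2 * Real.pi * b * |x|) : ℝ) : ℂ)) (Set.Iic 0) := by
    intro x hx
    simp only [abs_of_nonpos (Set.mem_Iic.1 hx), smul_eq_mul, ← Complex.exp_add, ha₁]
    push_cast; ring_nf
  have e₂ : Set.EqOn (fun x : ℝ => Complex.exp (a₂ * x)) (fun x : ℝ =>
      Complex.exp (((-2 * Real.pi * x * s : ℝ) : ℂ) * Complex.I) •
        Complex.exp ((-(2 * Real.pi * b * |x|) : ℝ) : ℂ)) (Set.Ioi 0) := by
    intro x hx
    simp only [abs_of_pos (Set.mem_Ioi.1 hx), smul_eq_mul, ← Complex.exp_add, ha₂]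
    push_cast; ring_nf
  have i₁ := (integrableOn_exp_mul_complex_Iic r₁ 0).congr_fun e₁ measurableSet_Iic
  have i₂ := (integrableOn_exp_mul_complex_Ioi r₂ 0).congr_fun e₂ measurableSet_Ioi
  rw [← intervalIntegral.integral_Iic_add_Ioi i₁ i₂, ← setIntegral_congr_fun measurableSet_Iic e₁,
    ← setIntegral_congr_fun measurableSet_Ioi e₂, integral_exp_mul_complex_Iic r₁,
    integral_exp_mul_complex_Ioi r₂, cauchyKernel]
  have n₁ : (b - s * Complex.I : ℂ) ≠ 0 := fun h => by
    have := congrArg Complex.re h; simp at this; exact hb.ne' this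
  have n₂ : (b + s * Complex.I : ℂ) ≠ 0 := fun h => by
    have := congrArg Complex.re h; simp at this; exact hb.ne' this
  have n₃ : (Real.pi : ℂ) ≠ 0 := by exact_mod_cast hpi.ne'
  have n₄ : (b ^ 2 + s ^ 2 : ℂ) = (b - s * Complex.I) * (b + s * Complex.I) := by
    ring_nf; rw [Complex.I_sq]; ring
  push_cast
  rw [n₄, ha₁, ha₂]
  simp only [mul_zero, Complex.exp_zero]
  field_simp
  ring

/-- Fourier inversion applied to the two-sided exponential, whose transform is integrable. -/
theorem integral_cauchyKernel_mul_expTwoPi {b : ℝ} (hb : 0 < b) (y : ℝ) :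
    ∫ s, (cauchyKernel b s : ℂ) * expTwoPi (s * y) = (Real.exp (-(2 * Real.pi * b * |y|)) : ℂ) := by
  have hc : 0 < 2 * Real.pi * b := by have := Real.pi_pos; positivity
  have hF := funext (fourier_exp_neg_mul_abs hb)
  have h := (integrable_exp_neg_mul_abs hc).fourierInv_fourier_eq (v := y)
    (by rw [hF]; exact (integrable_cauchyKernel hb).ofReal)
    (by fun_prop)
  rw [hF, Real.fourierInv_eq'] at h
  rw [Complex.ofReal_exp, ← h]
  congr 1
  ext s
  rw [smul_eq_mul, mul_comm, expTwoPi]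
  congr 2
  simp
  ring

/-! ### The mixed kernel: positivity and Fourier transform -/

/-- The alternating Gaussian superposition of Cauchy kernels. -/
noncomputable def mixedKernel (T s : ℝ) : ℝ :=
  ∑' j : ℕ, (-1) ^ j * Real.exp (-Real.pi * T * (j + 1 / 2) ^ 2) * cauchyKernel (j + 1 / 2) s

/-- In the explicit antiderivative the cosine vanishes at u = ±1/2, since the frequency is a
half-integer, and the sine there is ±(-1)^j. This is the source of the alternating sign in
`mixedKernel`. -/
theorem intervalIntegral_cos_mul_cosh (j : ℕ) (s : ℝ) :
    ∫ u in (-(1 / 2) : ℝ)..(1 / 2),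
      Real.cos (2 * Real.pi * ((j + 1 / 2) * u)) * Real.cosh (2 * Real.pi * s * u) =
      (-1) ^ j * cauchyKernel (j + 1 / 2) s * Real.cosh (Real.pi * s) := by
  set b : ℝ := j + 1 / 2 with hb
  have hb0 : 0 < b := by positivity
  have hpi := Real.pi_pos
  have hD : 0 < b ^ 2 + s ^ 2 := by positivity
  have hder : ∀ u ∈ Set.uIcc (-(1 / 2) : ℝ) (1 / 2), HasDerivAt (fun u : ℝ =>
      (b * (Real.sin (2 * Real.pi * b * u) * Real.cosh (2 * Real.pi * s * u)) +
        s * (Real.cos (2 * Real.pi * b * u) * Real.sinh (2 * Real.pi * s * u))) /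
          (2 * Real.pi * (b ^ 2 + s ^ 2)))
      (Real.cos (2 * Real.pi * (b * u)) * Real.cosh (2 * Real.pi * s * u)) u := by
    intro u _
    have l₁ : HasDerivAt (fun u : ℝ => 2 * Real.pi * b * u) (2 * Real.pi * b) u := by
      simpa using (hasDerivAt_id u).const_mul (2 * Real.pi * b)
    have l₂ : HasDerivAt (fun u : ℝ => 2 * Real.pi * s * u) (2 * Real.pi * s) u := by
      simpa using (hasDerivAt_id u).const_mul (2 * Real.pi * s)
    have := (((l₁.sin.mul l₂.cosh).const_mul b).add ((l₁.cos.mul l₂.sinh).const_mul s)).div_const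
      (2 * Real.pi * (b ^ 2 + s ^ 2))
    refine HasDerivAt.congr_deriv this ?_
    rw [div_eq_iff (by positivity), show 2 * Real.pi * (b * u) = 2 * Real.pi * b * u by ring]
    ring
  rw [intervalIntegral.integral_eq_sub_of_hasDerivAt hder
    (Continuous.intervalIntegrable (by fun_prop) _ _)]
  have s₁ : Real.sin (2 * Real.pi * b * (1 / 2)) = (-1) ^ j := by
    rw [show 2 * Real.pi * b * (1 / 2) = Real.pi / 2 + j * Real.pi by rw [hb]; ring,
      Real.sin_add_nat_mul_pi, Real.sin_pi_div_two, mul_one]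
  have c₁ : Real.cos (2 * Real.pi * b * (1 / 2)) = 0 := by
    rw [show 2 * Real.pi * b * (1 / 2) = Real.pi / 2 + j * Real.pi by rw [hb]; ring,
      Real.cos_add_nat_mul_pi, Real.cos_pi_div_two, mul_zero]
  simp only [mul_neg, Real.sin_neg, Real.cos_neg, Real.cosh_neg, s₁, c₁]
  rw [show 2 * Real.pi * s * (1 / 2) = Real.pi * s by ring, cauchyKernel]
  field_simp
  ring

theorem cauchyKernel_le (j : ℕ) (s : ℝ) : cauchyKernel (j + 1 / 2) s ≤ 1 := by
  have hpi := Real.pi_gt_three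
  have hj : (0 : ℝ) ≤ j := j.cast_nonneg
  rw [cauchyKernel, div_le_one (by positivity)]
  nlinarith [mul_nonneg hj hj, mul_nonneg hj (sub_nonneg.2 hpi.le),
    mul_nonneg (mul_nonneg hj hj) (sub_nonneg.2 hpi.le), sq_nonneg s,
    mul_nonneg (sq_nonneg s) (sub_nonneg.2 hpi.le)]

/-- Termwise integration of the theta series. It trades an alternating sum, whose sign is unclear,
for an integral of positive functions. -/
theorem cosh_mul_mixedKernel {T : ℝ} (hT : 0 < T) (s : ℝ) :
    Real.cosh (Real.pi * s) * mixedKernel T s =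
      ∫ u in (-(1 / 2) : ℝ)..(1 / 2), halfTheta T u * Real.cosh (2 * Real.pi * s * u) := by
  have h := intervalIntegral.hasSum_integral_of_dominated_convergence (μ := volume)
    (a := -(1 / 2)) (b := 1 / 2)
    (F := fun (j : ℕ) (u : ℝ) => Real.exp (-Real.pi * T * (j + 1 / 2) ^ 2) *
      (Real.cos (2 * Real.pi * ((j + 1 / 2) * u)) * Real.cosh (2 * Real.pi * s * u)))
    (f := fun u => halfTheta T u * Real.cosh (2 * Real.pi * s * u))
    (fun j u => Real.exp (-Real.pi * T * (j + 1 / 2) ^ 2) * Real.cosh (2 * Real.pi * s * u))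
    (fun j => (Continuous.aestronglyMeasurable (by fun_prop)))
    (fun j => .of_forall fun u _ => ?_)
    (.of_forall fun u _ => (summable_gaussian_nat hT).mul_right _)
    ?_ (.of_forall fun u _ => ?_)
  · simp_rw [intervalIntegral.integral_const_mul, intervalIntegral_cos_mul_cosh] at h
    rw [← h.tsum_eq, mixedKernel, ← tsum_mul_left]
    exact tsum_congr fun j => by ring
  · rw [norm_mul, norm_mul, Real.norm_of_nonneg (Real.exp_pos _).le,
      Real.norm_of_nonneg (Real.cosh_pos _).le, Real.norm_eq_abs]
    have := Real.abs_cos_le_one (2 * Real.pi * ((j + 1 / 2) * u))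
    have h0 := Real.cosh_pos (2 * Real.pi * s * u)
    gcongr
    exact mul_le_of_le_one_left h0.le this
  · simp_rw [tsum_mul_right]
    exact Continuous.intervalIntegrable (by fun_prop) _ _
  · simp_rw [← mul_assoc (Real.exp _)]
    refine HasSum.mul_right _ (Summable.hasSum ?_)
    refine Summable.of_norm_bounded (summable_gaussian_nat hT) fun j => ?_
    rw [norm_mul, Real.norm_of_nonneg (Real.exp_pos _).le, Real.norm_eq_abs]
    exact mul_le_of_le_one_right (Real.exp_pos _).le (Real.abs_cos_le_one _)

theorem continuous_halfTheta {T : ℝ} (hT : 0 < T) : Continuous (halfTheta T) := by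
  unfold halfTheta
  refine continuous_tsum (fun j => by fun_prop) (summable_gaussian_nat hT) fun j u => ?_
  rw [norm_mul, Real.norm_of_nonneg (Real.exp_pos _).le, Real.norm_eq_abs]
  exact mul_le_of_le_one_right (Real.exp_pos _).le (Real.abs_cos_le_one _)

theorem mixedKernel_pos {T : ℝ} (hT : 0 < T) (s : ℝ) : 0 < mixedKernel T s := by
  have h := cosh_mul_mixedKernel hT s
  have hpos : 0 < ∫ u in (-(1 / 2) : ℝ)..(1 / 2), halfTheta T u * Real.cosh (2 * Real.pi * s * u) := by
    refine intervalIntegral.intervalIntegral_pos_of_pos_on ?_ (fun u hu => ?_) (by norm_num)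
    · have := continuous_halfTheta hT
      exact Continuous.intervalIntegrable (by fun_prop) _ _
    · exact mul_pos (halfTheta_pos hT (abs_lt.2 hu)) (Real.cosh_pos _)
  rw [← h] at hpos
  exact pos_of_mul_pos_right hpos (Real.cosh_pos _).le

theorem continuous_mixedKernel {T : ℝ} (hT : 0 < T) : Continuous (mixedKernel T) := by
  unfold mixedKernel
  refine continuous_tsum (fun j => ?_) (summable_gaussian_nat hT) fun j s => ?_
  · exact continuous_const.mul (continuous_cauchyKernel (by positivity))
  · rw [norm_mul, norm_mul, norm_pow, norm_neg, norm_one, one_pow, one_mul,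
      Real.norm_of_nonneg (Real.exp_pos _).le,
      Real.norm_of_nonneg (cauchyKernel_nonneg (by positivity) _)]
    exact mul_le_of_le_one_right (Real.exp_pos _).le (cauchyKernel_le j s)

/-- The alternating Gaussian superposition of exponentials, the Fourier transform of
`mixedKernel`. -/
noncomputable def mixedExp (T y : ℝ) : ℝ :=
  ∑' j : ℕ, (-1) ^ j * Real.exp (-Real.pi * T * (j + 1 / 2) ^ 2) *
    Real.exp (-(2 * Real.pi * (j + 1 / 2) * |y|))

theorem integrable_mixedKernel {T : ℝ} (hT : 0 < T) : Integrable (mixedKernel T) := by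
  refine ⟨(continuous_mixedKernel hT).aestronglyMeasurable, ?_⟩
  rw [hasFiniteIntegral_iff_enorm]
  calc ∫⁻ s, ‖mixedKernel T s‖ₑ
      -- Absolute values discard the signs; each Cauchy kernel has mass 1, so the total is the
      -- Gaussian sum.
      ≤ ∫⁻ s, ∑' j : ℕ, ENNReal.ofReal (Real.exp (-Real.pi * T * (j + 1 / 2) ^ 2) *
          cauchyKernel (j + 1 / 2) s) := by
        refine lintegral_mono fun s => ?_
        have hs : Summable fun j : ℕ => Real.exp (-Real.pi * T * (j + 1 / 2) ^ 2) *
          cauchyKernel (j + 1 / 2) s := by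
          refine Summable.of_nonneg_of_le (fun j => ?_) (fun j => ?_) (summable_gaussian_nat hT)
          · exact mul_nonneg (Real.exp_pos _).le (cauchyKernel_nonneg (by positivity) _)
          · exact mul_le_of_le_one_right (Real.exp_pos _).le (cauchyKernel_le j s)
        rw [← ENNReal.ofReal_tsum_of_nonneg (fun j => mul_nonneg (Real.exp_pos _).le
          (cauchyKernel_nonneg (by positivity) _)) hs, ← ofReal_norm]
        refine ENNReal.ofReal_le_ofReal (tsum_of_norm_bounded hs.hasSum fun j => ?_)
        rw [norm_mul, norm_mul, norm_pow, norm_neg, norm_one, one_pow, one_mul,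
          Real.norm_of_nonneg (Real.exp_pos _).le,
          Real.norm_of_nonneg (cauchyKernel_nonneg (by positivity) _)]
    _ = ∑' j : ℕ, ENNReal.ofReal (Real.exp (-Real.pi * T * (j + 1 / 2) ^ 2)) := by
        have hm : ∀ j : ℕ, AEMeasurable fun s => ENNReal.ofReal
            (Real.exp (-Real.pi * T * (j + 1 / 2) ^ 2) * cauchyKernel (j + 1 / 2) s) := fun j =>
          ((continuous_cauchyKernel (b := j + 1 / 2) (by positivity)).measurable.const_mul
            _).ennreal_ofReal.aemeasurable
        rw [lintegral_tsum hm]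
        refine tsum_congr fun j => ?_
        have hj : (0 : ℝ) < j + 1 / 2 := by positivity
        rw [← ofReal_integral_eq_lintegral_ofReal ((integrable_cauchyKernel hj).const_mul _)
          (.of_forall fun s => mul_nonneg (Real.exp_pos _).le (cauchyKernel_nonneg hj _)),
          integral_const_mul, integral_cauchyKernel hj, mul_one]
    _ < ⊤ := by
        rw [← ENNReal.ofReal_tsum_of_nonneg (fun j => (Real.exp_pos _).le)
          (summable_gaussian_nat hT)]
        exact ENNReal.ofReal_lt_top

theorem integral_mixedKernel_mul_expTwoPi {T : ℝ} (hT : 0 < T) (y : ℝ) :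
    ∫ s, (mixedKernel T s : ℂ) * expTwoPi (s * y) = (mixedExp T y : ℂ) := by
  have hj : ∀ j : ℕ, (0 : ℝ) < j + 1 / 2 := fun j => by positivity
  set q : ℕ → ℝ := fun j => Real.exp (-Real.pi * T * (j + 1 / 2) ^ 2) with hq
  have hn : ∀ (j : ℕ) (s : ℝ), ‖((-1 : ℂ) ^ j * (q j : ℂ)) *
      ((cauchyKernel (j + 1 / 2) s : ℂ) * expTwoPi (s * y))‖ = q j * cauchyKernel (j + 1 / 2) s := by
    intro j s
    rw [norm_mul, norm_mul, norm_mul, norm_pow, norm_neg, norm_one, one_pow, one_mul,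
      norm_expTwoPi, mul_one, Complex.norm_real, Complex.norm_real,
      Real.norm_of_nonneg (Real.exp_pos _).le, Real.norm_of_nonneg (cauchyKernel_nonneg (hj j) _)]
  have h := integral_tsum_of_summable_integral_norm (μ := volume)
    (F := fun (j : ℕ) (s : ℝ) => ((-1 : ℂ) ^ j * (q j : ℂ)) *
      ((cauchyKernel (j + 1 / 2) s : ℂ) * expTwoPi (s * y))) (fun j => ?_) ?_
  · simp_rw [integral_const_mul, integral_cauchyKernel_mul_expTwoPi (hj _)] at h
    rw [mixedExp, Complex.ofReal_tsum]
    refine Eq.trans ?_ (h.symm.trans (tsum_congr fun j => by push_cast [hq]; ring))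
    congr 1
    ext s
    rw [mixedKernel, Complex.ofReal_tsum, ← tsum_mul_right]
    refine tsum_congr fun j => ?_
    simp only [hq]
    push_cast; ring
  · refine Integrable.const_mul ?_ _
    refine (integrable_cauchyKernel (hj j)).mono'
      (Continuous.aestronglyMeasurable ?_) (.of_forall fun s => ?_)
    · have := continuous_cauchyKernel (hj j)
      fun_prop
    · rw [norm_mul, norm_expTwoPi, mul_one, Complex.norm_real,
        Real.norm_of_nonneg (cauchyKernel_nonneg (hj j) _)]
  · simp_rw [hn, integral_const_mul, integral_cauchyKernel (hj _), mul_one]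
    exact summable_gaussian_nat hT

/-! ### Averages of translates of θ₃ -/

theorem continuous_thetaThree {lam : ℝ} (hlam : 0 < lam) :
    Continuous fun x : ℝ => thetaThree x (Complex.I / lam) := by
  have h : ∀ x : ℝ, thetaThree x (Complex.I / lam) =
      ∑' n : ℤ, (Real.exp (-Real.pi * (1 / lam) * n ^ 2) : ℂ) * expTwoPi (n * x) :=
    fun x => (hasSum_thetaThree hlam x).tsum_eq.symm
  simp_rw [h]
  have hs := summable_gaussian_shift (t := 1 / lam) (by positivity) 0
  simp only [add_zero] at hs
  refine continuous_tsum (fun n => by fun_prop) hs fun n x => ?_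
  rw [norm_mul, norm_expTwoPi, mul_one, Complex.norm_real, Real.norm_of_nonneg (Real.exp_pos _).le]

/-- The cosine series with coefficients `e^{-πn²/λ} · mixedExp T (κ n)` is positive. -/
theorem tsum_gaussian_mul_mixedExp_pos {lam T : ℝ} (hlam : 0 < lam) (hT : 0 < T) (κ x : ℝ) :
    ∃ r : ℝ, 0 < r ∧ ∑' n : ℤ, ((Real.exp (-Real.pi * (1 / lam) * n ^ 2) * mixedExp T (κ * n) : ℝ) : ℂ)
      * expTwoPi (n * x) = r := by
  have hs := summable_gaussian_shift (t := 1 / lam) (by positivity) 0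
  simp only [add_zero] at hs
  have hint : ∀ y : ℝ, Integrable fun s => (mixedKernel T s : ℂ) * expTwoPi (s * y) := fun y => by
    refine (integrable_mixedKernel hT).mono (Continuous.aestronglyMeasurable ?_)
      (.of_forall fun s => ?_)
    · have := continuous_mixedKernel hT
      fun_prop
    · rw [norm_mul, norm_expTwoPi, mul_one, Complex.norm_real]
  have h := integral_tsum_of_summable_integral_norm (μ := volume)
    (F := fun (n : ℤ) (s : ℝ) => ((Real.exp (-Real.pi * (1 / lam) * n ^ 2) : ℂ) * expTwoPi (n * x)) *
      ((mixedKernel T s : ℂ) * expTwoPi (s * (κ * n)))) (fun n => (hint _).const_mul _) ?_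
  · refine ⟨∫ s, mixedKernel T s * (thetaThree ((x + κ * s : ℝ) : ℂ) (Complex.I / lam)).re, ?_, ?_⟩
    · have hc := continuous_mixedKernel hT
      have hth := continuous_thetaThree hlam
      have hpos : ∀ s : ℝ, 0 < mixedKernel T s *
          (thetaThree ((x + κ * s : ℝ) : ℂ) (Complex.I / lam)).re :=
        fun s => mul_pos (mixedKernel_pos hT s) (thetaThree_pos hlam _)
      rw [integral_pos_iff_support_of_nonneg (fun s => (hpos s).le)]
      · rw [Function.support_eq_univ fun s => (hpos s).ne']
        simp
      · refine (integrable_mixedKernel hT).mul_bdd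
          (c := ∑' n : ℤ, Real.exp (-Real.pi * (1 / lam) * n ^ 2))
          (Continuous.aestronglyMeasurable ?_) (.of_forall fun s => ?_)
        · exact Complex.continuous_re.comp
            (hth.comp (g := fun x : ℝ => thetaThree x (Complex.I / lam)) (by fun_prop))
        · refine (Complex.abs_re_le_norm _).trans ?_
          rw [← (hasSum_thetaThree hlam _).tsum_eq]
          refine tsum_of_norm_bounded hs.hasSum fun n => ?_
          rw [norm_mul, norm_expTwoPi, mul_one, Complex.norm_real,
            Real.norm_of_nonneg (Real.exp_pos _).le]
    · rw [← integral_complex_ofReal]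
      simp_rw [integral_const_mul, integral_mixedKernel_mul_expTwoPi hT] at h
      refine Eq.trans ?_ (h.trans ?_)
      · refine tsum_congr fun n => ?_
        push_cast; ring
      · congr 1
        ext s
        have e : (((thetaThree ((x + κ * s : ℝ) : ℂ) (Complex.I / lam)).re : ℝ) : ℂ) =
            thetaThree ((x + κ * s : ℝ) : ℂ) (Complex.I / lam) := by
          rw [thetaThree_eq_periodized hlam, Complex.ofReal_re]
        rw [Complex.ofReal_mul, e, ← (hasSum_thetaThree hlam _).tsum_eq, ← tsum_mul_left]
        refine tsum_congr fun n => ?_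
        rw [show (n : ℝ) * (x + κ * s) = n * x + s * (κ * n) by ring, expTwoPi_add]
        ring
  · simp_rw [norm_mul, norm_expTwoPi, mul_one, Complex.norm_real]
    simp_rw [integral_const_mul]
    refine Summable.mul_right _ ?_
    simpa using hs

/-! ### The interpolation error -/

theorem summable_gaussian_progression {t M : ℝ} (ht : 0 < t) (hM : M ≠ 0) (y : ℝ) :
    Summable fun n : ℤ => Real.exp (-Real.pi * t * (y + n * M) ^ 2) := by
  refine (summable_gaussian_shift (t := t * M ^ 2) (by positivity) (y / M)).congr fun n => ?_
  congr 1
  field_simp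
  ring

/-- The alternating tail `∑_{j ≥ 0} (-1)^j e^{-π (y + (2j+1)L)² / λ}`. -/
noncomputable def altTail (lam L y : ℝ) : ℝ :=
  ∑' j : ℕ, (-1) ^ j * Real.exp (-Real.pi * (1 / lam) * (y + (2 * j + 1) * L) ^ 2)

theorem summable_altTail {lam L : ℝ} (hlam : 0 < lam) (hL : 0 < L) (y : ℝ) : Summable fun j : ℕ =>
    (-1 : ℝ) ^ j * Real.exp (-Real.pi * (1 / lam) * (y + (2 * j + 1) * L) ^ 2) := by
  have h := (summable_gaussian_progression (t := 1 / lam) (M := 2 * L) (by positivity)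
    (by positivity) (y + L)).comp_injective (i := fun n : ℕ => (n : ℤ)) Nat.cast_injective
  refine Summable.of_norm_bounded h fun j => ?_
  rw [norm_mul, norm_pow, norm_neg, norm_one, one_pow, one_mul,
    Real.norm_of_nonneg (Real.exp_pos _).le]
  refine le_of_eq ?_
  simp only [Function.comp, Int.cast_natCast]
  congr 2; ring

/-- The two series are the same up to one index shift, with opposite signs; only the term j = 0
survives. -/
theorem altTail_sub_add_altTail_add {lam L : ℝ} (hlam : 0 < lam) (hL : 0 < L) (y : ℝ) :
    altTail lam L (y - L) + altTail lam L (y + L) = Real.exp (-Real.pi * (1 / lam) * y ^ 2) := by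
  have h := (summable_altTail hlam hL (y - L)).tsum_eq_zero_add
  rw [altTail, h, altTail, add_assoc, ← (summable_nat_add_iff 1).2
    (summable_altTail hlam hL (y - L)) |>.tsum_add (summable_altTail hlam hL (y + L))]
  rw [tsum_congr (g := fun _ => (0 : ℝ)), tsum_zero]
  · simp
  · intro j
    have : y - L + (2 * ((j + 1 : ℕ) : ℝ) + 1) * L = y + L + (2 * j + 1) * L := by push_cast; ring
    rw [this, pow_succ]; ring

/-- The aliased Fourier coefficient: the `k`-th coefficient of the interpolating polynomial. -/
noncomputable def aliasCoeff (lam L y : ℝ) : ℝ :=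
  ∑' l : ℤ, (-1) ^ l * Real.exp (-Real.pi * (1 / lam) * (y + l * (2 * L)) ^ 2)

/-- The bilateral sum is split at l = 0: the indices l ≥ 0 form the first tail, and l = -(j+1) gives
the second with reversed sign. -/
theorem altTail_sub_sub_altTail_sub {lam L : ℝ} (hlam : 0 < lam) (hL : 0 < L) (y : ℝ) :
    altTail lam L (y - L) - altTail lam L (L - y) = aliasCoeff lam L y := by
  have hs : Summable fun l : ℤ =>
      (-1 : ℝ) ^ l * Real.exp (-Real.pi * (1 / lam) * (y + l * (2 * L)) ^ 2) := by
    refine Summable.of_norm_bounded (summable_gaussian_progression (t := 1 / lam) (M := 2 * L)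
      (by positivity) (by positivity) y) fun n => ?_
    rw [norm_mul, norm_zpow, norm_neg, norm_one, one_zpow, one_mul,
      Real.norm_of_nonneg (Real.exp_pos _).le]
  rw [aliasCoeff, ← tsum_nat_add_neg_add_one hs, altTail, altTail,
    ← (summable_altTail hlam hL (y - L)).tsum_sub (summable_altTail hlam hL (L - y))]
  refine tsum_congr fun j => ?_
  have h1 : (y - L + (2 * (j : ℝ) + 1) * L) = y + ((j : ℤ) : ℝ) * (2 * L) := by push_cast; ring
  have h2 : (L - y + (2 * (j : ℝ) + 1) * L) ^ 2 = (y + ((-((j : ℤ) + 1) : ℤ) : ℝ) * (2 * L)) ^ 2 := by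
    push_cast; ring
  have h3 : (-1 : ℝ) ^ (-((j : ℤ) + 1)) = -(-1) ^ j := by
    rw [zpow_neg, ← inv_zpow, inv_neg, inv_one, zpow_add_one₀ (by norm_num), zpow_natCast]
    ring
  rw [h1, h2, h3, zpow_natCast]
  ring

/-- Expand (|y| + (2j+1)L)²: the square of |y| leaves the sum, the cross term is the exponential in
`mixedExp`, and (2j+1)²L²/λ = T(j + 1/2)² fixes T = 4L²/λ. -/
theorem altTail_abs_eq {lam L : ℝ} (hlam : 0 < lam) (hL : 0 < L) (y : ℝ) :
    altTail lam L |y| = Real.exp (-Real.pi * (1 / lam) * y ^ 2) *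
      mixedExp (4 * L ^ 2 / lam) (2 * L / lam * y) := by
  rw [altTail, mixedExp, ← tsum_mul_left]
  refine tsum_congr fun j => ?_
  rw [mul_left_comm, mul_assoc, mul_left_comm, mul_assoc, ← Real.exp_add, ← Real.exp_add, abs_mul,
    abs_of_nonneg (by positivity : 0 ≤ 2 * L / lam), ← sq_abs y]
  congr 2
  field_simp
  ring

theorem abs_mixedExp_le {T : ℝ} (hT : 0 < T) (y : ℝ) :
    |mixedExp T y| ≤ ∑' j : ℕ, Real.exp (-Real.pi * T * (j + 1 / 2) ^ 2) := by
  rw [← Real.norm_eq_abs]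
  refine tsum_of_norm_bounded (summable_gaussian_nat hT).hasSum fun j => ?_
  rw [norm_mul, norm_mul, norm_pow, norm_neg, norm_one, one_pow, one_mul,
    Real.norm_of_nonneg (Real.exp_pos _).le, Real.norm_of_nonneg (Real.exp_pos _).le]
  refine mul_le_of_le_one_right (Real.exp_pos _).le (Real.exp_le_one_iff.2 ?_)
  have := Real.pi_pos
  have : 0 ≤ 2 * Real.pi * (j + 1 / 2) * |y| := by positivity
  linarith

theorem summable_altTail_mul_expTwoPi {lam L : ℝ} (hlam : 0 < lam) (hL : 0 < L) (x : ℝ) :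
    Summable fun m : ℤ => (altTail lam L |(m : ℝ)| : ℂ) * expTwoPi (m * x) := by
  have hs := summable_gaussian_shift (t := 1 / lam) (by positivity) 0
  simp only [add_zero] at hs
  refine Summable.of_norm_bounded (hs.mul_right
    (∑' j : ℕ, Real.exp (-Real.pi * (4 * L ^ 2 / lam) * (j + 1 / 2) ^ 2))) fun m => ?_
  rw [norm_mul, norm_expTwoPi, mul_one, Complex.norm_real,
    altTail_abs_eq hlam hL (m : ℝ), norm_mul,
    Real.norm_of_nonneg (Real.exp_pos _).le]
  exact mul_le_mul_of_nonneg_left (abs_mixedExp_le (by positivity) _) (Real.exp_pos _).le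

/-- The interpolating trigonometric polynomial of `θ₃`. -/
noncomputable def interpPoly (lam : ℝ) (N : ℕ) (x : ℝ) : ℂ :=
  ∑ k ∈ Finset.Icc (-(N : ℤ)) N, (aliasCoeff lam (N + 1) k : ℂ) * expTwoPi (k * x)

/-- With L = N+1: for |m| > N the numbers m ± L are both nonnegative or both nonpositive, and the
telescoping identity at |m| applies. For |m| ≤ N one has m - L < 0 < m + L; replacing m - L by its
absolute value changes the sum by exactly the aliased coefficient. -/
theorem altTail_abs_sub_add_altTail_abs_add {lam : ℝ} (hlam : 0 < lam) (N : ℕ) (m : ℤ) :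
    altTail lam (N + 1) |((m - (N + 1) : ℤ) : ℝ)| + altTail lam (N + 1) |((m + (N + 1) : ℤ) : ℝ)| =
      Real.exp (-Real.pi * (1 / lam) * m ^ 2) -
        if m ∈ Finset.Icc (-(N : ℤ)) N then aliasCoeff lam (N + 1) m else 0 := by
  have hL : (0 : ℝ) < N + 1 := by positivity
  have key := altTail_sub_add_altTail_add hlam hL (m : ℝ)
  have key2 := altTail_sub_sub_altTail_sub hlam hL (m : ℝ)
  have key' := altTail_sub_add_altTail_add hlam hL (-m : ℝ)
  have e1 : ((m - (N + 1) : ℤ) : ℝ) = m - (N + 1) := by push_cast; ring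
  have e2 : ((m + (N + 1) : ℤ) : ℝ) = m + (N + 1) := by push_cast; ring
  rw [e1, e2]
  split_ifs with h
  · obtain ⟨h1, h2⟩ := Finset.mem_Icc.1 h
    have h1' : -(N : ℝ) ≤ m := by exact_mod_cast h1
    have h2' : (m : ℝ) ≤ N := by exact_mod_cast h2
    rw [abs_of_nonpos (by linarith), abs_of_nonneg (by linarith), neg_sub]
    linarith
  · rw [Finset.mem_Icc, not_and_or, not_le, not_le] at h
    rcases h with h | h
    · have h' : (m : ℝ) + 1 ≤ -N := by exact_mod_cast h
      rw [abs_of_nonpos (by linarith), abs_of_nonpos (by linarith), neg_sub, neg_add', sub_zero,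
        ← neg_sq, ← key']
      ring_nf
    · have h' : (N : ℝ) + 1 ≤ m := by exact_mod_cast h
      rw [abs_of_nonneg (by linarith), abs_of_nonneg (by linarith)]
      linarith

/-- Multiplication by 2cos(2πLx) shifts the coefficients by ±L and adds, so the identity is the
preceding one coefficient by coefficient. -/
theorem thetaThree_sub_interpPoly {lam : ℝ} (hlam : 0 < lam) (N : ℕ) (x : ℝ) :
    thetaThree x (Complex.I / lam) - interpPoly lam N x =
      2 * (Real.cos (2 * Real.pi * ((N + 1) * x)) : ℂ) *
        ∑' m : ℤ, (altTail lam (N + 1) |(m : ℝ)| : ℂ) * expTwoPi (m * x) := by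
  have hL : (0 : ℝ) < N + 1 := by positivity
  have hs := (summable_altTail_mul_expTwoPi hlam hL x).hasSum
  set S := ∑' m : ℤ, (altTail lam (N + 1) |(m : ℝ)| : ℂ) * expTwoPi (m * x)
  have h1 := ((Equiv.subRight ((N : ℤ) + 1)).hasSum_iff.2 hs).mul_left (expTwoPi ((N + 1) * x))
  have h2 := ((Equiv.addRight ((N : ℤ) + 1)).hasSum_iff.2 hs).mul_left (expTwoPi (-((N + 1) * x)))
  have h3 := h1.add h2
  rw [← add_mul, expTwoPi_add_neg] at h3
  have hP : HasSum (fun k : ℤ => if k ∈ Finset.Icc (-(N : ℤ)) N then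
      (aliasCoeff lam (N + 1) k : ℂ) * expTwoPi (k * x) else 0) (interpPoly lam N x) := by
    have := hasSum_sum_of_ne_finset_zero (L := SummationFilter.unconditional ℤ) (s := Finset.Icc (-(N : ℤ)) N) (f := fun k : ℤ =>
      if k ∈ Finset.Icc (-(N : ℤ)) N then
      (aliasCoeff lam (N + 1) k : ℂ) * expTwoPi (k * x) else 0) (fun k hk => if_neg hk)
    rwa [Finset.sum_congr rfl (fun k hk => if_pos hk)] at this
  rw [← ((hasSum_thetaThree hlam x).sub hP).tsum_eq, ← h3.tsum_eq]
  refine tsum_congr fun m => ?_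
  have key := altTail_abs_sub_add_altTail_abs_add hlam N m
  have e1 : expTwoPi (((m - ((N : ℤ) + 1) : ℤ) : ℝ) * x) = expTwoPi (m * x) * expTwoPi (-((N + 1) * x)) := by
    rw [← expTwoPi_add]; push_cast; ring_nf
  have e2 : expTwoPi (((m + ((N : ℤ) + 1) : ℤ) : ℝ) * x) = expTwoPi (m * x) * expTwoPi ((N + 1) * x) := by
    rw [← expTwoPi_add]; push_cast; ring_nf
  have e3 : expTwoPi ((N + 1) * x) * expTwoPi (-((N + 1) * x)) = 1 := by
    rw [← expTwoPi_add, add_neg_cancel, expTwoPi_zero]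
  simp only [Function.comp, Equiv.subRight_apply, Equiv.coe_addRight]
  rw [e1, e2]
  have key' := congrArg (fun r : ℝ => (r : ℂ)) key
  simp only [Complex.ofReal_add, Complex.ofReal_sub] at key'
  have e4 : (if m ∈ Finset.Icc (-(N : ℤ)) N then (aliasCoeff lam (N + 1) m : ℂ) * expTwoPi (m * x)
      else 0) = ((if m ∈ Finset.Icc (-(N : ℤ)) N then aliasCoeff lam (N + 1) m else 0 : ℝ) : ℂ) *
        expTwoPi (m * x) := by
    split_ifs <;> simp
  rw [e4]
  linear_combination (-expTwoPi (m * x)) * key' -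
    ((altTail lam (N + 1) |((m - (N + 1) : ℤ) : ℝ)| : ℂ) +
      (altTail lam (N + 1) |((m + (N + 1) : ℤ) : ℝ)| : ℂ)) * expTwoPi (m * x) * e3

/-- The error of interpolation is `cos (2π(N+1)x)` times a positive function. -/
theorem exists_pos_thetaThree_sub_interpPoly {lam : ℝ} (hlam : 0 < lam) (N : ℕ) (x : ℝ) :
    ∃ r : ℝ, 0 < r ∧ thetaThree x (Complex.I / lam) - interpPoly lam N x =
      ((Real.cos (2 * Real.pi * ((N + 1) * x)) * r : ℝ) : ℂ) := by
  have hL : (0 : ℝ) < N + 1 := by positivity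
  obtain ⟨r, hr, h⟩ := tsum_gaussian_mul_mixedExp_pos hlam
    (T := 4 * ((N : ℝ) + 1) ^ 2 / lam) (by positivity) (2 * (N + 1) / lam) x
  refine ⟨2 * r, by positivity, ?_⟩
  rw [thetaThree_sub_interpPoly hlam]
  simp_rw [altTail_abs_eq hlam hL]
  rw [h]
  push_cast; ring

/-! ### Identification of k with the interpolating polynomial -/

/-- Subtracting the second fraction allows unconditional summation over ℤ; pairing n with -n then
gives the two cotangent expansions. -/
theorem tsum_one_div_add_sub_one_div_add {s t : ℂ} (hs : s ∈ Complex.integerComplement)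
    (ht : t ∈ Complex.integerComplement)
    (h : Summable fun n : ℤ => 1 / (s + n) - 1 / (t + n)) :
    ∑' n : ℤ, (1 / (s + n) - 1 / (t + n)) =
      Real.pi * Complex.cot (Real.pi * s) - Real.pi * Complex.cot (Real.pi * t) := by
  -- This folding counts n = 0 twice, which the next step isolates.
  have h1 := h.hasSum.nat_add_neg
  have h2 := h1.summable.tsum_eq_zero_add
  rw [h1.tsum_eq] at h2
  have h3 := cot_series_rep' hs
  have h4 := cot_series_rep' ht
  have h5 := (summable_cotTerm hs).tsum_sub (summable_cotTerm ht)
  have h6 : ∑' n : ℕ, ((1 / (s + ((n + 1 : ℕ) : ℤ)) - 1 / (t + ((n + 1 : ℕ) : ℤ))) +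
      (1 / (s + (-((n + 1 : ℕ) : ℤ) : ℤ)) - 1 / (t + (-((n + 1 : ℕ) : ℤ) : ℤ)))) =
      ∑' n, (cotTerm s n - cotTerm t n) := by
    refine tsum_congr fun n => ?_
    simp only [cotTerm]
    push_cast
    ring
  rw [h6, h5] at h2
  simp only [cotTerm] at h2
  rw [← h3, ← h4] at h2
  push_cast at h2
  simp only [add_zero, neg_zero] at h2
  linear_combination h2

theorem sum_Icc_neg_eq_sum_range {E : Type*} [AddCommMonoid E] (N : ℕ) (f : ℤ → E) :
    ∑ k ∈ Finset.Icc (-(N : ℤ)) N, f k = ∑ i ∈ Finset.range (2 * N + 1), f ((i : ℤ) - N) := by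
  refine Finset.sum_bij' (fun k _ => (k + N).toNat) (fun i _ => (i : ℤ) - N) ?_ ?_ ?_ ?_ ?_
  · intro k hk
    rw [Finset.mem_Icc] at hk
    rw [Finset.mem_range]; omega
  · intro i hi
    rw [Finset.mem_range] at hi
    rw [Finset.mem_Icc]; omega
  · intro k hk
    rw [Finset.mem_Icc] at hk
    omega
  · intro i hi
    omega
  · intro k hk
    rw [Finset.mem_Icc] at hk
    congr 1; omega

/-- Dirichlet kernel: 2i sin(πy) = e(y/2) - e(-y/2) makes the sum telescope. -/
theorem sin_mul_sum_expTwoPi (N : ℕ) (y : ℝ) :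
    (Real.sin (Real.pi * y) : ℂ) * ∑ k ∈ Finset.Icc (-(N : ℤ)) N, expTwoPi (k * y) =
      (Real.sin ((2 * N + 1) * (Real.pi * y)) : ℂ) := by
  have h1 := expTwoPi_sub_neg (y / 2)
  have h2 := expTwoPi_sub_neg ((2 * N + 1) * (y / 2))
  rw [show 2 * Real.pi * (y / 2) = Real.pi * y by ring] at h1
  rw [show 2 * Real.pi * ((2 * N + 1) * (y / 2)) = (2 * N + 1) * (Real.pi * y) by ring] at h2
  have h3 : (expTwoPi (y / 2) - expTwoPi (-(y / 2))) *
      ∑ k ∈ Finset.Icc (-(N : ℤ)) N, expTwoPi (k * y) =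
      expTwoPi ((2 * N + 1) * (y / 2)) - expTwoPi (-((2 * N + 1) * (y / 2))) := by
    rw [sum_Icc_neg_eq_sum_range, Finset.mul_sum]
    have := Finset.sum_range_sub (fun i : ℕ => expTwoPi ((i - N - 1 / 2) * y)) (2 * N + 1)
    rw [show ((2 * N + 1) * (y / 2)) = (((2 * N + 1 : ℕ) : ℝ) - N - 1 / 2) * y by push_cast; ring,
      show -((((2 * N + 1 : ℕ) : ℝ) - N - 1 / 2) * y) = (((0 : ℕ) : ℝ) - N - 1 / 2) * y by
        push_cast; ring, ← this]
    refine Finset.sum_congr rfl fun i _ => ?_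
    rw [sub_mul, ← expTwoPi_add, ← expTwoPi_add]
    push_cast; ring_nf
  rw [h1, h2] at h3
  have : (2 * Complex.I : ℂ) ≠ 0 := by simp
  refine mul_left_cancel₀ this ?_
  linear_combination h3

/-- `cos (πMx) cot (π(x - a/M))` for a half-integer `a` and even `M = 2N + 2`. -/
theorem cos_mul_cot_eq (N : ℕ) (x : ℝ) (j : ℤ)
    (hy : Real.sin (Real.pi * (x - (j + 1 / 2) / (2 * N + 2))) ≠ 0) :
    (Real.cos (Real.pi * ((2 * N + 2) * x)) : ℂ) * ((-1) ^ (j + 1) *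
      Complex.cot (Real.pi * ((x - (j + 1 / 2) / (2 * N + 2) : ℝ) : ℂ))) =
    ∑ k ∈ Finset.Icc (-(N : ℤ)) N, expTwoPi (k * (x - (j + 1 / 2) / (2 * N + 2))) +
      (-1) ^ j * (Real.sin (Real.pi * ((2 * N + 2) * x)) : ℂ) := by
  set y : ℝ := x - (j + 1 / 2) / (2 * N + 2) with hydef
  have hM : (2 * N + 2 : ℝ) ≠ 0 := by positivity
  have hx : Real.pi * ((2 * N + 2) * x) =
      ((2 * N + 2) * (Real.pi * y) + Real.pi / 2) + j * Real.pi := by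
    rw [hydef]; field_simp; ring
  have hdir := sin_mul_sum_expTwoPi N y
  set D := ∑ k ∈ Finset.Icc (-(N : ℤ)) N, expTwoPi (k * y)
  have hcot : Complex.cot (Real.pi * (y : ℂ)) =
      ((Real.cos (Real.pi * y) : ℝ) : ℂ) / ((Real.sin (Real.pi * y) : ℝ) : ℂ) := by
    rw [Complex.cot]; push_cast; rfl
  have hy' : ((Real.sin (Real.pi * y) : ℝ) : ℂ) ≠ 0 := by exact_mod_cast hy
  have hsub : Real.sin ((2 * N + 1) * (Real.pi * y)) =
      Real.sin ((2 * N + 2) * (Real.pi * y)) * Real.cos (Real.pi * y) -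
        Real.cos ((2 * N + 2) * (Real.pi * y)) * Real.sin (Real.pi * y) := by
    rw [← Real.sin_sub]; ring_nf
  have hone : (-1 : ℂ) ^ j * (-1) ^ j = 1 := by
    rw [← mul_zpow]; norm_num
  rw [hx, Real.cos_add_int_mul_pi, Real.sin_add_int_mul_pi, Real.cos_add_pi_div_two,
    Real.sin_add_pi_div_two, hcot, zpow_add_one₀ (by norm_num)]
  rw [hsub] at hdir
  generalize (2 * (N : ℝ) + 2) * (Real.pi * y) = A at hdir ⊢
  push_cast at hdir hy' ⊢
  field_simp
  linear_combination (-1 : ℂ) * hdir + (Complex.sin A * Complex.cos (Real.pi * y) -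
    Complex.cos A * Complex.sin (Real.pi * y)) * hone

/-- The difference is m/((w-m)w), and |w| ≤ |w-m|(1 + |m|/δ). The bound separates into a polynomial
in |m|, absorbed by the Gaussian, and |w|⁻², summable over translates. -/
theorem one_div_sub_le {w δ : ℝ} (hδ : 0 < δ) (hw : ∀ m : ℤ, δ ≤ |w - m|) (m : ℤ) :
    |1 / (w - m) - 1 / w| ≤ |(m : ℝ)| * (1 + |(m : ℝ)| / δ) * (1 / |w| ^ 2) := by
  have h0 := hw 0
  rw [Int.cast_zero, sub_zero] at h0
  have hm := hw m
  have hw0 : 0 < |w| := hδ.trans_le h0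
  have hm0 : 0 < |w - m| := hδ.trans_le hm
  have e : 1 / (w - m) - 1 / w = m / ((w - m) * w) := by
    have := abs_pos.1 hw0
    have := abs_pos.1 hm0
    field_simp; ring
  have hle : |w| ≤ |w - m| * (1 + |(m : ℝ)| / δ) := by
    have t : |w| ≤ |w - m| + |(m : ℝ)| := by simpa using abs_add_le (w - m) m
    have : |(m : ℝ)| ≤ |w - m| * (|(m : ℝ)| / δ) := by
      rw [mul_div_assoc', le_div_iff₀ hδ, mul_comm]
      gcongr
    linarith
  rw [e, abs_div, abs_mul, div_le_iff₀ (by positivity)]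
  have : |(m : ℝ)| * (1 + |(m : ℝ)| / δ) * (1 / |w| ^ 2) * (|w - m| * |w|) =
      |(m : ℝ)| * ((|w - m| * (1 + |(m : ℝ)| / δ)) / |w|) := by
    field_simp
  rw [this]
  refine le_mul_of_one_le_right (abs_nonneg _) ?_
  rwa [le_div_iff₀ hw0, one_mul]

theorem exists_dist_int_pos {w : ℝ} (hw : ∀ m : ℤ, w ≠ m) : ∃ δ > 0, ∀ m : ℤ, δ ≤ |w - m| :=
  ⟨|w - round w|, abs_pos.2 (sub_ne_zero.2 (hw _)), fun m => round_le w m⟩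

theorem summable_poly_mul_gaussian {t : ℝ} (ht : 0 < t) (c : ℝ) :
    Summable fun j : ℤ => Real.exp (-Real.pi * t * (j + 1 / 2) ^ 2) *
      (|(j : ℝ)| * (1 + |(j : ℝ)| * c)) := by
  have h1 := summable_pow_mul_jacobiTheta₂_term_bound (t / 2) ht 1
  have h2 := (summable_pow_mul_jacobiTheta₂_term_bound (t / 2) ht 2).mul_left |c|
  refine Summable.of_norm_bounded (h1.add h2) fun j => ?_
  have hpi := Real.pi_pos
  have he : Real.exp (-Real.pi * t * (j + 1 / 2) ^ 2) ≤
      Real.exp (-Real.pi * (t * j ^ 2 - 2 * (t / 2) * |(j : ℝ)|)) := by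
    refine Real.exp_le_exp.2 ?_
    have := neg_abs_le (j : ℝ)
    have hpt : 0 < Real.pi * t := by positivity
    nlinarith [mul_nonneg hpt.le (by linarith : 0 ≤ |(j : ℝ)| + j)]
  rw [norm_mul, Real.norm_of_nonneg (Real.exp_pos _).le, norm_mul, Real.norm_eq_abs, Real.norm_eq_abs,
    abs_abs]
  have h3 : |1 + |(j : ℝ)| * c| ≤ 1 + |(j : ℝ)| * |c| := by
    refine (abs_add_le _ _).trans ?_
    rw [abs_one, abs_mul, abs_abs]
  calc _ ≤ Real.exp (-Real.pi * (t * j ^ 2 - 2 * (t / 2) * |(j : ℝ)|)) *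
        (|(j : ℝ)| * (1 + |(j : ℝ)| * |c|)) := by gcongr
    _ = _ := by push_cast; ring

/-- The reflection j ↦ -1-j preserves the Gaussian and flips the sign. Hence any contribution
independent of j, multiplied by these weights, sums to zero. -/
theorem tsum_alternating_gaussian {t : ℝ} :
    ∑' j : ℤ, (-1 : ℂ) ^ (j + 1) * (Real.exp (-Real.pi * t * (j + 1 / 2) ^ 2) : ℂ) = 0 := by
  set f : ℤ → ℂ := fun j => (-1 : ℂ) ^ (j + 1) * (Real.exp (-Real.pi * t * (j + 1 / 2) ^ 2) : ℂ)
  have h : ∑' j, f j = ∑' j, -f j := by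
    rw [← (Equiv.subLeft (-1 : ℤ)).tsum_eq]
    refine tsum_congr fun j => ?_
    have e1 : (((-1 - j : ℤ) : ℝ) + 1 / 2) ^ 2 = (j + 1 / 2) ^ 2 := by push_cast; ring
    have e2 : (-1 : ℂ) ^ (-1 - j + 1) = -(-1) ^ (j + 1) := by
      rw [show -1 - j + 1 = -j by ring, zpow_neg, ← inv_zpow, inv_neg, inv_one,
        zpow_add_one₀ (by norm_num)]
      ring
    simp only [f, Equiv.subLeft_apply]
    rw [e1, e2]; ring
  rw [tsum_neg] at h
  exact self_eq_neg.1 h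

theorem gaussianG_ofReal (lam y : ℝ) :
    gaussianG lam y = (Real.exp (-Real.pi * lam * y ^ 2) : ℂ) := by
  rw [gaussianG, Complex.ofReal_exp]; push_cast; rfl

theorem interpPoly_eq_thetaThree_of_node {lam : ℝ} (hlam : 0 < lam) (N : ℕ) {x : ℝ} {m : ℤ}
    (hx : (2 * N + 2) * x = m + 1 / 2) : interpPoly lam N x = thetaThree x (Complex.I / lam) := by
  obtain ⟨r, -, h⟩ := exists_pos_thetaThree_sub_interpPoly hlam N x
  have : 2 * Real.pi * ((N + 1) * x) = Real.pi / 2 + m * Real.pi := by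
    linear_combination Real.pi * hx
  rw [this, Real.cos_add_int_mul_pi, Real.cos_pi_div_two, mul_zero, zero_mul, Complex.ofReal_zero,
    sub_eq_zero] at h
  exact h.symm

/-- As 2N+2 is an integer, all translates of a node are half-integers, so the series is the
periodised Gaussian itself. -/
theorem kSum_eq_thetaThree_of_node {lam : ℝ} (hlam : 0 < lam) (N : ℕ) {x : ℝ} {m : ℤ}
    (hx : (2 * N + 2) * x = m + 1 / 2) : kSum lam N x = thetaThree x (Complex.I / lam) := by
  rw [kSum, thetaThree_eq_periodized hlam, Complex.ofReal_mul, Complex.ofReal_tsum]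
  congr 1
  refine tsum_congr fun n => ?_
  have hM : (2 * N + 2 : ℝ) ≠ 0 := by positivity
  have e : ((2 * (N : ℂ) + 2) * ((x : ℂ) + n)) = (((2 * N + 2) * (x + n) : ℝ) : ℂ) := by
    push_cast; ring
  have hnode : ∃ k : ℤ, ((2 * (N : ℂ) + 2) * ((x : ℂ) + n)) = (k : ℂ) + 1 / 2 := by
    refine ⟨m + (2 * N + 2) * n, ?_⟩
    have := congrArg (fun r : ℝ => (r : ℂ)) hx
    push_cast at this ⊢
    linear_combination this
  rw [entireK, if_pos hnode, e, gaussianG_ofReal]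
  congr 2
  field_simp
  ring

/-- Poisson summation at u = -k/M with M = 2N+2; rescaling by M places the dual Gaussians on the
progression k + lM. -/
theorem tsum_gaussian_mul_expTwoPi_eq_aliasCoeff {lam : ℝ} (hlam : 0 < lam) (N : ℕ) (k : ℤ) :
    ∑' j : ℤ, (Real.exp (-Real.pi * (lam / (2 * N + 2) ^ 2) * (j + 1 / 2) ^ 2) : ℂ) *
      expTwoPi ((j + 1 / 2) * (-k / (2 * N + 2))) =
      (((2 * N + 2) / Real.sqrt lam * aliasCoeff lam (N + 1) k : ℝ) : ℂ) := by
  have hM : (0 : ℝ) < 2 * N + 2 := by positivity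
  rw [tsum_gaussian_half_int (by positivity), aliasCoeff, Complex.ofReal_mul, Complex.ofReal_tsum,
    Real.sqrt_div hlam.le, Real.sqrt_sq hM.le, one_div_div]
  congr 1
  rw [← (Equiv.neg ℤ).tsum_eq]
  refine tsum_congr fun l => ?_
  have e : -Real.pi * (1 / (lam / (2 * N + 2) ^ 2)) * (((-l : ℤ) : ℝ) + -k / (2 * N + 2)) ^ 2 =
      -Real.pi * (1 / lam) * (k + l * (2 * (N + 1))) ^ 2 := by
    push_cast; field_simp; ring
  rw [Equiv.neg_apply, e, zpow_neg, ← inv_zpow, inv_neg, inv_one]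
  push_cast; ring

theorem kSum_eq_interpPoly_of_not_node {lam : ℝ} (hlam : 0 < lam) (N : ℕ) {x : ℝ}
    (hx : ∀ m : ℤ, (2 * N + 2) * x ≠ m + 1 / 2) : kSum lam N x = interpPoly lam N x := by
  have hM : (0 : ℝ) < 2 * N + 2 := by positivity
  set M : ℝ := 2 * N + 2 with hMdef
  set μ : ℝ := lam / M ^ 2 with hμdef
  have hμ : 0 < μ := by positivity
  set D : ℝ := x - 1 / 2 / M with hD
  set C : ℝ := Real.cos (Real.pi * (M * x)) with hC
  set S : ℝ := Real.sin (Real.pi * (M * x)) with hS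
  set g : ℤ → ℝ := fun j => Real.exp (-Real.pi * μ * (j + 1 / 2) ^ 2) with hg
  have hg0 : ∀ j, 0 ≤ g j := fun j => (Real.exp_pos _).le
  set s : ℤ → ℂ := fun j => (-1 : ℂ) ^ (j + 1) * (g j : ℂ) with hs
  have hsn : ∀ j, ‖s j‖ = g j := fun j => by
    simp only [hs]
    rw [norm_mul, norm_zpow, norm_neg, norm_one, one_zpow, one_mul, Complex.norm_real,
      Real.norm_of_nonneg (hg0 j)]
  have hgs : Summable g := summable_gaussian_shift hμ (1 / 2)
  have hss : Summable s := Summable.of_norm_bounded hgs fun j => (hsn j).le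
  have hs0 : ∑' j, s j = 0 := tsum_alternating_gaussian
  have hw : ∀ m : ℤ, M * D ≠ m := fun m h => hx m (by
    rw [hD] at h; field_simp at h; linarith)
  obtain ⟨δ, hδ, hδw⟩ := exists_dist_int_pos hw
  have hδn : ∀ n m : ℤ, δ ≤ |M * (D + n) - m| := fun n m => by
    have := hδw (m - (2 * N + 2) * n)
    convert this using 2
    rw [hMdef]; push_cast; ring
  have hne : ∀ n m : ℤ, M * (D + n) - m ≠ 0 := fun n m => abs_pos.1 (hδ.trans_le (hδn n m))
  -- The subtracted 1/(M(D+n)) does not change the sum over j, because the weights `s` sum to zero,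
  -- but makes the double series absolutely summable, so that the order of summation may be
  -- exchanged.
  set F : ℤ → ℤ → ℂ := fun j n =>
    s j * ((1 / (M * (D + n) - j) - 1 / (M * (D + n)) : ℝ) : ℂ) with hF
  have hFs : Summable (Function.uncurry F) := by
    have b2 : Summable fun n : ℤ => 1 / |M * (D + n)| ^ 2 := by
      have := ((Real.summable_one_div_int_add_rpow D 2).2 (by norm_num)).mul_left (1 / M ^ 2)
      refine this.congr fun n => ?_
      rw [abs_mul, mul_pow, abs_of_pos hM, Real.rpow_ofNat, add_comm D]
      ring_nf
    have b1 := summable_poly_mul_gaussian hμ (1 / δ)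
    refine Summable.of_norm_bounded (b1.mul_of_nonneg b2 (fun j => by positivity)
      (fun n => by positivity)) ?_
    rintro ⟨j, n⟩
    simp only [Function.uncurry, hF]
    rw [norm_mul, hsn, Complex.norm_real, Real.norm_eq_abs]
    have := one_div_sub_le hδ (hδn n) j
    calc _ ≤ g j * (|(j : ℝ)| * (1 + |(j : ℝ)| / δ) * (1 / |M * (D + n)| ^ 2)) := by
          gcongr
      _ = _ := by simp only [hg]; ring
  have hK : ∀ n : ℤ, entireK μ ((2 * (N : ℂ) + 2) * ((x : ℂ) + n)) = (C / Real.pi : ℂ) * ∑' j, F j n := by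
    intro n
    have hzw : ∀ j : ℤ, (2 * (N : ℂ) + 2) * ((x : ℂ) + n) - j - 1 / 2 =
        ((M * (D + n) - j : ℝ) : ℂ) := by
      intro j
      have : M * (D + n) - j = (2 * N + 2) * (x + n) - j - 1 / 2 := by
        rw [hD, ← hMdef]; field_simp; ring
      rw [this]; push_cast; ring
    have hnn : ¬ ∃ m : ℤ, (2 * (N : ℂ) + 2) * ((x : ℂ) + n) = (m : ℂ) + 1 / 2 := by
      rintro ⟨m, h⟩
      have h1 := hzw m
      rw [h] at h1
      have : ((M * (D + n) - m : ℝ) : ℂ) = 0 := by rw [← h1]; ring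
      exact hne n m (by exact_mod_cast this)
    have hcos : Complex.cos (Real.pi * ((2 * (N : ℂ) + 2) * ((x : ℂ) + n))) = (C : ℂ) := by
      -- M is even, so the cosine factor is the same for all translates.
      have : Real.cos (Real.pi * (M * (x + n))) = C := by
        rw [hC, ← Real.cos_add_int_mul_two_pi (Real.pi * (M * x)) ((N + 1) * n)]
        congr 1; rw [hMdef]; push_cast; ring
      rw [← this, hMdef]; push_cast; rfl
    rw [entireK, if_neg hnn, hcos]
    congr 1
    have hsum1 : Summable fun j : ℤ => s j * ((1 / (M * (D + n) - j) : ℝ) : ℂ) := by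
      refine Summable.of_norm_bounded (hgs.mul_right (1 / δ)) fun j => ?_
      rw [norm_mul, hsn, Complex.norm_real, Real.norm_eq_abs, abs_div, abs_one]
      have := hδn n j
      have := hg0 j
      gcongr
    have hsum2 : Summable fun j : ℤ => s j * ((1 / (M * (D + n)) : ℝ) : ℂ) := hss.mul_right _
    have e1 : ∑' j, F j n = ∑' j : ℤ, s j * ((1 / (M * (D + n) - j) : ℝ) : ℂ) := by
      have := hsum1.tsum_sub hsum2
      rw [tsum_mul_right, hs0, zero_mul, sub_zero] at this
      rw [← this]
      refine tsum_congr fun j => ?_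
      simp only [hF]
      push_cast; ring
    rw [e1]
    refine tsum_congr fun j => ?_
    have hG : gaussianG μ ((j : ℂ) + 1 / 2) = (g j : ℂ) := by
      have := gaussianG_ofReal μ (j + 1 / 2)
      push_cast at this
      rw [this]; simp only [hg]; push_cast; rfl
    rw [hzw, hG]
    simp only [hs]
    push_cast; ring
  have hDc : ∀ j : ℤ, ((D - j / M : ℝ) : ℂ) ∈ Complex.integerComplement := by
    rintro j ⟨m, hm⟩
    have h1 : (m : ℝ) = D - j / M := by exact_mod_cast hm
    have := hne (-m) j
    apply this
    push_cast
    rw [h1]; field_simp; ring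
  have hcol : ∀ j : ℤ, ∑' n, F j n = s j * ((Real.pi / M : ℝ) : ℂ) *
      (Complex.cot (Real.pi * ((D - j / M : ℝ) : ℂ)) - Complex.cot (Real.pi * (D : ℂ))) := by
    intro j
    rcases eq_or_ne (s j) 0 with h0 | h0
    · simp [hF, h0]
    have hj := (hFs.prod_factor j)
    have e : ∀ n : ℤ, F j n = s j * ((1 / M : ℝ) : ℂ) *
        (1 / (((D - j / M : ℝ) : ℂ) + n) - 1 / ((D : ℂ) + n)) := by
      intro n
      have h1 := hne n j
      have h2 := hne n 0
      have h1' : D - j / M + n ≠ 0 := fun h => h1 (by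
        have : M * (D + n) - j = M * (D - j / M + n) := by field_simp; ring
        rw [this, h, mul_zero])
      have h2' : D + n ≠ 0 := fun h => h2 (by rw [h]; simp)
      have : (1 / (M * (D + n) - j) - 1 / (M * (D + n)) : ℝ) =
          1 / M * (1 / (D - j / M + n) - 1 / (D + n)) := by
        rw [show M * (D + n) - j = M * (D - j / M + n) by field_simp; ring]
        field_simp
      simp only [hF]
      rw [this]; push_cast; ring
    have hM' : ((1 / M : ℝ) : ℂ) ≠ 0 := by
      have : (1 / M : ℝ) ≠ 0 := by positivity
      exact_mod_cast this
    have hsum : Summable fun n : ℤ => (1 / (((D - j / M : ℝ) : ℂ) + n) - 1 / ((D : ℂ) + n)) :=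
      (summable_mul_left_iff (mul_ne_zero h0 hM')).1 (hj.congr e)
    have hD0 := hDc 0
    simp only [Int.cast_zero, zero_div, sub_zero] at hD0
    rw [tsum_congr e, tsum_mul_left, tsum_one_div_add_sub_one_div_add (hDc j) hD0 hsum]
    push_cast; ring
  -- The cosine converts the j-dependent cotangent into a Dirichlet kernel; what remains is `s j`
  -- times a constant and disappears in the sum over j.
  have hcolC : ∀ j : ℤ, (C : ℂ) * ∑' n, F j n = ((Real.pi / M : ℝ) : ℂ) *
      ((g j : ℂ) * ∑ k ∈ Finset.Icc (-(N : ℤ)) N, expTwoPi (k * (x - (j + 1 / 2) / M)) -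
        s j * (S + C * Complex.cot (Real.pi * (D : ℂ)))) := by
    intro j
    have hDj : D - j / M = x - (j + 1 / 2) / M := by rw [hD]; field_simp; ring
    have hsin : Real.sin (Real.pi * (x - (j + 1 / 2) / M)) ≠ 0 := by
      rw [← hDj]
      intro h
      obtain ⟨m, hm⟩ := Real.sin_eq_zero_iff.1 h
      have h1 : (m : ℝ) = D - j / M := by
        have := Real.pi_pos.ne'
        apply mul_left_cancel₀ this
        linarith
      exact hDc j ⟨m, by exact_mod_cast congrArg (fun r : ℝ => (r : ℂ)) h1⟩
    have key := cos_mul_cot_eq N x j hsin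
    rw [← hMdef] at key
    rw [hcol, hDj]
    have h2 : (-1 : ℂ) ^ j = -(-1) ^ (j + 1) := by rw [zpow_add_one₀ (by norm_num)]; ring
    rw [h2] at key
    simp only [hs]
    linear_combination ((Real.pi / M : ℝ) : ℂ) * (g j : ℂ) * key
  have hgk : ∀ k : ℤ, Summable fun j : ℤ => (g j : ℂ) * expTwoPi (k * (x - (j + 1 / 2) / M)) :=
    fun k => summable_ofReal_mul_expTwoPi hgs hg0 _
  have htot : (C : ℂ) * ∑' n, ∑' j, F j n = ((Real.pi / Real.sqrt lam : ℝ) : ℂ) * interpPoly lam N x := by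
    rw [hFs.tsum_comm, ← tsum_mul_left, tsum_congr hcolC, tsum_mul_left,
      Summable.tsum_sub _ (hss.mul_right _), tsum_mul_right, hs0, zero_mul, sub_zero]
    · simp_rw [Finset.mul_sum]
      rw [Summable.tsum_finsetSum fun k _ => hgk k, interpPoly, Finset.mul_sum, Finset.mul_sum]
      refine Finset.sum_congr rfl fun k _ => ?_
      have e : ∀ j : ℤ, (g j : ℂ) * expTwoPi (k * (x - (j + 1 / 2) / M)) =
          expTwoPi (k * x) * ((g j : ℂ) * expTwoPi ((j + 1 / 2) * (-k / M))) := by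
        intro j
        rw [show (k : ℝ) * (x - (j + 1 / 2) / M) = k * x + (j + 1 / 2) * (-k / M) by ring,
          expTwoPi_add]
        ring
      rw [tsum_congr e, tsum_mul_left, tsum_gaussian_mul_expTwoPi_eq_aliasCoeff hlam N k]
      have : (Real.pi / M) * ((2 * N + 2) / Real.sqrt lam * aliasCoeff lam (N + 1) k) =
          Real.pi / Real.sqrt lam * aliasCoeff lam (N + 1) k := by
        rw [← hMdef]; field_simp
      have := congrArg (fun r : ℝ => (r : ℂ)) this
      simp only [Complex.ofReal_mul] at this ⊢
      linear_combination expTwoPi (k * x) * this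
    · simp_rw [Finset.mul_sum]
      exact summable_sum fun k _ => hgk k
  have hsl : Real.sqrt lam ≠ 0 := (Real.sqrt_pos.2 hlam).ne'
  have hpi := Real.pi_pos.ne'
  have hsl' : (Real.sqrt lam : ℂ) ≠ 0 := by exact_mod_cast hsl
  have hpi' : (Real.pi : ℂ) ≠ 0 := by exact_mod_cast hpi
  rw [kSum, ← hMdef, ← hμdef, tsum_congr hK, tsum_mul_left, div_mul_eq_mul_div, htot]
  push_cast
  field_simp

/-- The periodised interpolation of the Gaussian is the interpolating trigonometric polynomial. -/
theorem kSum_eq_interpPoly {lam : ℝ} (hlam : 0 < lam) (N : ℕ) (x : ℝ) :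
    kSum lam N x = interpPoly lam N x := by
  by_cases h : ∃ m : ℤ, (2 * N + 2) * x = m + 1 / 2
  · obtain ⟨m, hm⟩ := h
    rw [kSum_eq_thetaThree_of_node hlam N hm, interpPoly_eq_thetaThree_of_node hlam N hm]
  · push Not at h
    exact kSum_eq_interpPoly_of_not_node hlam N h

/-! ### Passage to the circle and folding into cells -/

theorem fourier_eq_expTwoPi (n : ℤ) (x : ℝ) : fourier n (x : UnitAddCircle) = expTwoPi (n * x) := by
  rw [fourier_coe_apply, expTwoPi]
  push_cast
  congr 1
  ring

theorem kCircle_coe {lam : ℝ} (hlam : 0 < lam) (N : ℕ) (x : ℝ) :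
    kCircle lam N (x : UnitAddCircle) = interpPoly lam N x :=
  kSum_eq_interpPoly hlam N x

theorem isTrigPolyOfDegreeLE_kCircle {lam : ℝ} (hlam : 0 < lam) (N : ℕ) :
    IsTrigPolyOfDegreeLE N (kCircle lam N) := by
  refine ⟨fun k => aliasCoeff lam (N + 1) k, fun x => ?_⟩
  induction x using QuotientAddGroup.induction_on with
  | H x =>
    rw [kCircle_coe hlam, interpPoly]
    exact Finset.sum_congr rfl fun k _ => by rw [fourier_eq_expTwoPi]

/-- Folding an integral over the circle into a sum of translates over one cell. -/
theorem integral_circle_eq_integral_sum {f : UnitAddCircle → ℝ}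
    (hf : Continuous fun x : ℝ => f x) {M : ℕ} (hM : 0 < M) :
    ∫ x : UnitAddCircle, f x =
      ∫ x in (-(1 / (2 * M)) : ℝ)..(1 / (2 * M)), ∑ i ∈ Finset.range M, f ((x + i / M : ℝ)) := by
  have hM' : (0 : ℝ) < M := by exact_mod_cast hM
  rw [← UnitAddCircle.intervalIntegral_preimage (-(1 / (2 * M) : ℝ)) f,
    intervalIntegral.integral_finsetSum]
  · have h := intervalIntegral.sum_integral_adjacent_intervals (μ := volume) (n := M)
      (f := fun x : ℝ => f x) (a := fun i : ℕ => (i : ℝ) / M - 1 / (2 * M))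
      (fun i _ => hf.intervalIntegrable _ _)
    have e1 : (((0 : ℕ) : ℝ) / M - 1 / (2 * M)) = -(1 / (2 * M)) := by simp
    have e2 : ((M : ℝ) / M - 1 / (2 * M)) = -(1 / (2 * M)) + 1 := by
      rw [div_self hM'.ne']; ring
    rw [e1, e2] at h
    rw [← h]
    refine Finset.sum_congr rfl fun i _ => ?_
    have := intervalIntegral.integral_comp_add_right (a := -(1 / (2 * M) : ℝ)) (b := 1 / (2 * M))
      (fun x : ℝ => f x) ((i : ℝ) / M)
    rw [this]
    congr 1
    · ring
    · push_cast; field_simp; ring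
  · intro i _
    exact (hf.comp (g := fun x : ℝ => f x) (by fun_prop)).intervalIntegrable _ _

/-! ### Alternating sums over translates -/

theorem expTwoPi_eq_one_iff (x : ℝ) : expTwoPi x = 1 ↔ ∃ n : ℤ, x = n := by
  rw [expTwoPi, Complex.exp_eq_one_iff]
  refine exists_congr fun n => ?_
  have h : (2 * Real.pi * Complex.I : ℂ) ≠ 0 := Complex.two_pi_I_ne_zero
  rw [mul_comm (n : ℂ), mul_right_inj' h]
  exact_mod_cast Iff.rfl

theorem sum_alternating_expTwoPi_eq (N : ℕ) (n : ℤ) (x : ℝ) :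
    ∑ i ∈ Finset.range (2 * N + 2), (-1 : ℂ) ^ i * expTwoPi (n * (x + i / (2 * N + 2))) =
      expTwoPi (n * x) * ∑ i ∈ Finset.range (2 * N + 2),
        expTwoPi (n / (2 * N + 2) + 1 / 2) ^ i := by
  rw [Finset.mul_sum]
  refine Finset.sum_congr rfl fun i _ => ?_
  rw [expTwoPi_add, expTwoPi_half, mul_pow, ← expTwoPi_nat_mul, ← mul_assoc, ← expTwoPi_add,
    mul_comm]
  congr 2
  ring

/-- A full geometric sum whose ratio e(n/M + 1/2), M = 2N+2, is an M-th root of unity; the ratio is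
1 exactly when n is an odd multiple of N+1. -/
theorem sum_alternating_expTwoPi_of_ne (N : ℕ) (n : ℤ) (x : ℝ)
    (hn : ∀ r : ℤ, n ≠ (2 * r + 1) * (N + 1)) :
    ∑ i ∈ Finset.range (2 * N + 2), (-1 : ℂ) ^ i * expTwoPi (n * (x + i / (2 * N + 2))) = 0 := by
  have hM : (0 : ℝ) < 2 * N + 2 := by positivity
  rw [sum_alternating_expTwoPi_eq]
  have h1 : expTwoPi (n / (2 * N + 2) + 1 / 2) ≠ 1 := by
    rw [Ne, expTwoPi_eq_one_iff]
    rintro ⟨m, hm⟩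
    apply hn (m - 1)
    have : (n : ℝ) = (2 * ((m - 1 : ℤ) : ℝ) + 1) * (N + 1) := by
      have h2 : (n : ℝ) / (2 * N + 2) = m - 1 / 2 := by linarith
      rw [div_eq_iff hM.ne'] at h2
      rw [h2]; push_cast; ring
    exact_mod_cast this
  have h2 : expTwoPi (n / (2 * N + 2) + 1 / 2) ^ (2 * N + 2) = 1 := by
    rw [← expTwoPi_nat_mul, expTwoPi_eq_one_iff]
    refine ⟨n + (N + 1), ?_⟩
    push_cast; field_simp
  rw [geom_sum_eq h1, h2, sub_self, zero_div, mul_zero]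

theorem sum_alternating_expTwoPi_of_eq (N : ℕ) (r : ℤ) (x : ℝ) :
    ∑ i ∈ Finset.range (2 * N + 2), (-1 : ℂ) ^ i *
      expTwoPi (((2 * r + 1) * (N + 1) : ℤ) * (x + i / (2 * N + 2))) =
      (2 * N + 2) * expTwoPi ((r + 1 / 2) * ((2 * N + 2) * x)) := by
  have h1 : expTwoPi (((2 * r + 1) * (N + 1) : ℤ) / (2 * N + 2) + 1 / 2) = 1 := by
    rw [expTwoPi_eq_one_iff]
    refine ⟨r + 1, ?_⟩
    push_cast; field_simp; ring
  rw [sum_alternating_expTwoPi_eq, h1]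
  simp only [one_pow, Finset.sum_const, Finset.card_range, nsmul_eq_mul, mul_one]
  rw [mul_comm]
  push_cast
  congr 2
  ring

theorem thetaOne_eq_halfTheta {lam : ℝ} (hlam : 0 < lam) (N : ℕ) (u : ℝ) :
    thetaOne (u : ℂ) (Complex.I * (2 * N + 2) ^ 2 / lam) =
      ((2 * halfTheta ((2 * N + 2) ^ 2 / lam) u : ℝ) : ℂ) := by
  rw [two_mul_halfTheta (by positivity), thetaOne]
  refine tsum_congr fun n => ?_
  rw [Complex.ofReal_exp, expTwoPi]
  congr 2
  · push_cast
    linear_combination (Real.pi * (2 * N + 2) ^ 2 / lam * ((n : ℂ) + 1 / 2) ^ 2) * Complex.I_mul_I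
  · push_cast; ring

/-- Only n = (2r+1)(N+1) = M(r + 1/2) survives, which turns the θ₃ series into a θ₁ series with
parameter scaled by M². -/
theorem sum_alternating_thetaThree {lam : ℝ} (hlam : 0 < lam) (N : ℕ) (x : ℝ) :
    ∑ i ∈ Finset.range (2 * N + 2), (-1 : ℂ) ^ i *
      thetaThree ((x + i / (2 * N + 2) : ℝ) : ℂ) (Complex.I / lam) =
      (((2 * N + 2) * (2 * halfTheta ((2 * N + 2) ^ 2 / lam) ((2 * N + 2) * x)) : ℝ) : ℂ) := by
  have h1 := hasSum_sum (s := Finset.range (2 * N + 2)) fun i _ =>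
    (hasSum_thetaThree hlam (x + i / (2 * N + 2))).mul_left ((-1 : ℂ) ^ i)
  rw [← h1.tsum_eq]
  have hterm : ∀ n : ℤ, ∑ i ∈ Finset.range (2 * N + 2), (-1 : ℂ) ^ i *
      ((Real.exp (-Real.pi * (1 / lam) * n ^ 2) : ℂ) * expTwoPi (n * (x + i / (2 * N + 2)))) =
      (Real.exp (-Real.pi * (1 / lam) * n ^ 2) : ℂ) * ∑ i ∈ Finset.range (2 * N + 2),
        (-1 : ℂ) ^ i * expTwoPi (n * (x + i / (2 * N + 2))) := by
    intro n
    rw [Finset.mul_sum]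
    exact Finset.sum_congr rfl fun i _ => by ring
  rw [tsum_congr hterm]
  have hinj : Function.Injective fun r : ℤ => (2 * r + 1) * ((N : ℤ) + 1) := by
    intro r s h
    have : (2 * r + 1 : ℤ) = 2 * s + 1 := mul_right_cancel₀ (by positivity) h
    omega
  rw [← hinj.tsum_eq]
  · rw [Complex.ofReal_mul, two_mul_halfTheta (by positivity), ← tsum_mul_left]
    refine tsum_congr fun r => ?_
    rw [sum_alternating_expTwoPi_of_eq]
    have e : -Real.pi * (1 / lam) * (((2 * r + 1) * ((N : ℤ) + 1) : ℤ) : ℝ) ^ 2 =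
        -Real.pi * ((2 * N + 2) ^ 2 / lam) * (r + 1 / 2) ^ 2 := by
      push_cast; field_simp
    rw [e]
    push_cast; ring
  · intro n hn
    by_contra hr
    apply hn
    simp only
    rw [sum_alternating_expTwoPi_of_ne, mul_zero]
    intro r h
    exact hr ⟨r, h.symm⟩

theorem sum_alternating_trigPoly (N : ℕ) (c : ℤ → ℂ) (x : ℝ) :
    ∑ i ∈ Finset.range (2 * N + 2), (-1 : ℂ) ^ i *
      ∑ n ∈ Finset.Icc (-(N : ℤ)) N, c n * expTwoPi (n * (x + i / (2 * N + 2))) = 0 := by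
  simp_rw [Finset.mul_sum]
  rw [Finset.sum_comm]
  refine Finset.sum_eq_zero fun n hn => ?_
  rw [Finset.mem_Icc] at hn
  have := sum_alternating_expTwoPi_of_ne N n x (fun r h => by
    rcases le_or_gt 0 r with hr | hr
    · nlinarith
    · have : r + 1 ≤ 0 := hr
      nlinarith)
  calc _ = c n * ∑ i ∈ Finset.range (2 * N + 2), (-1 : ℂ) ^ i *
        expTwoPi (n * (x + i / (2 * N + 2))) := by
        rw [Finset.mul_sum]
        exact Finset.sum_congr rfl fun i _ => by ring
    _ = 0 := by rw [this, mul_zero]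

/-! ### Uniqueness of interpolation and the extremal value -/

/-- A trigonometric polynomial of degree at most `N` with `2N + 1` zeros in a period vanishes. -/
theorem trigPoly_eq_zero_of_zeros (N : ℕ) (c : ℤ → ℂ) (t : ℕ → ℝ)
    (ht : Set.InjOn (fun i => expTwoPi (t i)) (Finset.range (2 * N + 1)))
    (h0 : ∀ i ∈ Finset.range (2 * N + 1),
      ∑ n ∈ Finset.Icc (-(N : ℤ)) N, c n * expTwoPi (n * t i) = 0) (x : ℝ) :
    ∑ n ∈ Finset.Icc (-(N : ℤ)) N, c n * expTwoPi (n * x) = 0 := by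
  -- Multiplication by e(Nx) gives an ordinary polynomial in e(x) of degree at most 2N.
  set Q : Polynomial ℂ := ∑ i ∈ Finset.range (2 * N + 1),
    Polynomial.C (c ((i : ℤ) - N)) * Polynomial.X ^ i with hQ
  have heval : ∀ y : ℝ, Q.eval (expTwoPi y) =
      expTwoPi y ^ N * ∑ n ∈ Finset.Icc (-(N : ℤ)) N, c n * expTwoPi (n * y) := by
    intro y
    rw [sum_Icc_neg_eq_sum_range, Finset.mul_sum, hQ, Polynomial.eval_finsetSum]
    refine Finset.sum_congr rfl fun i _ => ?_
    rw [Polynomial.eval_mul, Polynomial.eval_C, Polynomial.eval_pow, Polynomial.eval_X,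
      ← expTwoPi_nat_mul, ← expTwoPi_nat_mul, mul_left_comm, ← expTwoPi_add]
    push_cast
    ring_nf
  have hdeg : Q.degree < ((2 * N + 1 : ℕ) : WithBot ℕ) := by
    refine lt_of_le_of_lt (Polynomial.degree_sum_le _ _) ?_
    rw [Finset.sup_lt_iff (WithBot.bot_lt_coe _)]
    intro i hi
    refine lt_of_le_of_lt (Polynomial.degree_C_mul_X_pow_le _ _) ?_
    exact_mod_cast Finset.mem_range.1 hi
  have hQ0 : Q = 0 := by
    refine Polynomial.eq_zero_of_degree_lt_of_eval_index_eq_zero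
      (s := Finset.range (2 * N + 1)) (v := fun i => expTwoPi (t i)) ht ?_ fun i hi => ?_
    · rwa [Finset.card_range]
    · rw [heval, h0 i hi, mul_zero]
  have := heval x
  rw [hQ0, Polynomial.eval_zero] at this
  exact (mul_eq_zero.1 this.symm).resolve_left (pow_ne_zero _ (expTwoPi_ne_zero _))

/-- The extremal value, as a real integral. -/
theorem integral_thetaOne_eq {lam : ℝ} (hlam : 0 < lam) (N : ℕ) :
    ∫ u in (-(1 / 2) : ℝ)..(1 / 2), thetaOne (u : ℂ) (Complex.I * (2 * N + 2) ^ 2 / lam) =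
      ((∫ x in (-(1 / (2 * (2 * N + 2 : ℕ))) : ℝ)..(1 / (2 * (2 * N + 2 : ℕ))),
        (2 * N + 2) * (2 * halfTheta ((2 * N + 2) ^ 2 / lam) ((2 * N + 2) * x)) : ℝ) : ℂ) := by
  have hM : (2 * N + 2 : ℝ) ≠ 0 := by positivity
  simp_rw [thetaOne_eq_halfTheta hlam]
  rw [intervalIntegral.integral_ofReal, intervalIntegral.integral_const_mul (2 * N + 2 : ℝ),
    intervalIntegral.integral_comp_mul_left
      (fun u => 2 * halfTheta ((2 * N + 2) ^ 2 / lam) u) hM, smul_eq_mul, ← mul_assoc,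
    mul_inv_cancel₀ hM, one_mul]
  congr 2
  · push_cast; field_simp
  · push_cast; field_simp

/-! ### The L¹ gap and the case of equality -/

section Approximation

variable {lam : ℝ} {N : ℕ} {p : UnitAddCircle → ℂ}

theorem thetaThreeCircle_coe (τ : ℂ) (x : ℝ) :
    thetaThreeCircle τ (x : UnitAddCircle) = thetaThree x τ := rfl

theorem continuous_thetaThreeCircle_sub (hlam : 0 < lam) (hp : IsTrigPolyOfDegreeLE N p) :
    Continuous fun x : ℝ => thetaThreeCircle (Complex.I / lam) (x : UnitAddCircle) - p x := by
  obtain ⟨c, hc⟩ := hp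
  simp_rw [thetaThreeCircle_coe, hc, fourier_eq_expTwoPi]
  have := continuous_thetaThree hlam
  fun_prop

theorem sum_alternating_thetaThreeCircle_sub (hlam : 0 < lam) (hp : IsTrigPolyOfDegreeLE N p)
    (x : ℝ) :
    ∑ i ∈ Finset.range (2 * N + 2), (-1 : ℂ) ^ i *
      (thetaThreeCircle (Complex.I / lam) ((x + i / (2 * N + 2) : ℝ) : UnitAddCircle) -
        p ((x + i / (2 * N + 2) : ℝ) : UnitAddCircle)) =
      (((2 * N + 2) * (2 * halfTheta ((2 * N + 2) ^ 2 / lam) ((2 * N + 2) * x)) : ℝ) : ℂ) := by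
  obtain ⟨c, hc⟩ := hp
  simp_rw [mul_sub, Finset.sum_sub_distrib, thetaThreeCircle_coe, hc, fourier_eq_expTwoPi]
  rw [sum_alternating_thetaThree hlam, sum_alternating_trigPoly, sub_zero]

/-- The signed sum over translates does not depend on p, so the excess over the extremal value is an
integral of nonnegative terms. -/
theorem integral_norm_sub_integral_eq (hlam : 0 < lam) (hp : IsTrigPolyOfDegreeLE N p) :
    (∫ x : UnitAddCircle, ‖thetaThreeCircle (Complex.I / lam) x - p x‖) -
      ∫ x in (-(1 / (2 * (2 * N + 2 : ℕ))) : ℝ)..(1 / (2 * (2 * N + 2 : ℕ))),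
        (2 * N + 2) * (2 * halfTheta ((2 * N + 2) ^ 2 / lam) ((2 * N + 2) * x)) =
    ∫ x in (-(1 / (2 * (2 * N + 2 : ℕ))) : ℝ)..(1 / (2 * (2 * N + 2 : ℕ))),
      ∑ i ∈ Finset.range (2 * N + 2),
        (‖thetaThreeCircle (Complex.I / lam) ((x + i / (2 * N + 2) : ℝ) : UnitAddCircle) -
          p ((x + i / (2 * N + 2) : ℝ) : UnitAddCircle)‖ -
        ((-1 : ℂ) ^ i * (thetaThreeCircle (Complex.I / lam)
          ((x + i / (2 * N + 2) : ℝ) : UnitAddCircle) -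
            p ((x + i / (2 * N + 2) : ℝ) : UnitAddCircle))).re) := by
  have hcont := continuous_thetaThreeCircle_sub hlam hp
  rw [integral_circle_eq_integral_sum (M := 2 * N + 2) hcont.norm (by positivity),
    ← intervalIntegral.integral_sub]
  · refine intervalIntegral.integral_congr fun x _ => ?_
    simp only [Finset.sum_sub_distrib]
    rw [← Complex.re_sum, sum_alternating_thetaThreeCircle_sub hlam hp, Complex.ofReal_re]
    push_cast
    rfl
  · refine Continuous.intervalIntegrable (continuous_finsetSum _ fun i _ => ?_) _ _
    exact hcont.norm.comp (g := fun x : ℝ => ‖thetaThreeCircle (Complex.I / lam)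
      (x : UnitAddCircle) - p x‖) (by fun_prop)
  · have := continuous_halfTheta (T := (2 * N + 2) ^ 2 / lam) (by positivity)
    exact Continuous.intervalIntegrable (by fun_prop) _ _

theorem re_neg_one_pow_mul_le_norm (i : ℕ) (z : ℂ) : ((-1 : ℂ) ^ i * z).re ≤ ‖z‖ := by
  refine (Complex.re_le_norm _).trans (le_of_eq ?_)
  rw [norm_mul, norm_pow, norm_neg, norm_one, one_pow, one_mul]

/-- Translation by i/(2N+2) multiplies cos(2π(N+1)x) by (-1)^i, and the cosine is nonnegative on the
central cell; the other factor of the error is positive everywhere. -/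
theorem norm_error_kCircle (hlam : 0 < lam) (i : ℕ) {x : ℝ}
    (hx : |x| ≤ 1 / (2 * (2 * N + 2))) :
    ‖thetaThreeCircle (Complex.I / lam) ((x + i / (2 * N + 2) : ℝ) : UnitAddCircle) -
      kCircle lam N ((x + i / (2 * N + 2) : ℝ) : UnitAddCircle)‖ =
    ((-1 : ℂ) ^ i * (thetaThreeCircle (Complex.I / lam)
      ((x + i / (2 * N + 2) : ℝ) : UnitAddCircle) -
        kCircle lam N ((x + i / (2 * N + 2) : ℝ) : UnitAddCircle))).re := by
  obtain ⟨r, hr, h⟩ := exists_pos_thetaThree_sub_interpPoly hlam N (x + i / (2 * N + 2))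
  have hM : (0 : ℝ) < 2 * N + 2 := by positivity
  rw [thetaThreeCircle_coe, kCircle_coe hlam, h]
  have e : 2 * Real.pi * ((N + 1) * (x + i / (2 * N + 2))) =
      2 * Real.pi * ((N + 1) * x) + i * Real.pi := by
    field_simp
  have hc : 0 ≤ Real.cos (2 * Real.pi * ((N + 1) * x)) := by
    obtain ⟨h1, h2⟩ := abs_le.1 hx
    have e2 : (N + 1) * (1 / (2 * (2 * N + 2)) : ℝ) = 1 / 4 := by field_simp; ring
    have h3 : (N + 1) * x ≤ (N + 1) * (1 / (2 * (2 * N + 2))) := by gcongr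
    have h4 : (N + 1) * -(1 / (2 * (2 * N + 2))) ≤ (N + 1) * x := by gcongr
    have := Real.pi_pos
    apply Real.cos_nonneg_of_mem_Icc
    constructor <;> nlinarith
  have hsq : (-1 : ℂ) ^ i * (-1) ^ i = 1 := by rw [← mul_pow]; norm_num
  rw [e, Real.cos_add_nat_mul_pi, Complex.norm_real, norm_mul, norm_mul, norm_pow, norm_neg,
    norm_one, one_pow, one_mul, Real.norm_of_nonneg hc, Real.norm_of_nonneg hr.le]
  have : (-1 : ℂ) ^ i * (((-1) ^ i * Real.cos (2 * Real.pi * ((N + 1) * x)) * r : ℝ) : ℂ) =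
      ((Real.cos (2 * Real.pi * ((N + 1) * x)) * r : ℝ) : ℂ) := by
    rw [Complex.ofReal_mul, Complex.ofReal_mul, Complex.ofReal_mul, Complex.ofReal_pow,
      Complex.ofReal_neg, Complex.ofReal_one]
    linear_combination ((Real.cos (2 * Real.pi * ((N + 1) * x)) : ℂ) * r) * hsq
  rw [this, Complex.ofReal_re]

/-- If the error is minimal then it vanishes at the nodes. -/
theorem eq_at_nodes_of_integral_eq_zero (hlam : 0 < lam) (hp : IsTrigPolyOfDegreeLE N p)
    (h : ∫ x in (-(1 / (2 * (2 * N + 2 : ℕ))) : ℝ)..(1 / (2 * (2 * N + 2 : ℕ))),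
      ∑ i ∈ Finset.range (2 * N + 2),
        (‖thetaThreeCircle (Complex.I / lam) ((x + i / (2 * N + 2) : ℝ) : UnitAddCircle) -
          p ((x + i / (2 * N + 2) : ℝ) : UnitAddCircle)‖ -
        ((-1 : ℂ) ^ i * (thetaThreeCircle (Complex.I / lam)
          ((x + i / (2 * N + 2) : ℝ) : UnitAddCircle) -
            p ((x + i / (2 * N + 2) : ℝ) : UnitAddCircle))).re) = 0)
    {i : ℕ} (hi : i ∈ Finset.range (2 * N + 1)) :
    thetaThreeCircle (Complex.I / lam) (((i + 1 / 2) / (2 * N + 2) : ℝ) : UnitAddCircle) =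
      p (((i + 1 / 2) / (2 * N + 2) : ℝ) : UnitAddCircle) := by
  have hM : (0 : ℝ) < 2 * N + 2 := by positivity
  set b : ℝ := 1 / (2 * (2 * N + 2 : ℕ)) with hb
  have hb' : b = 1 / 2 / (2 * N + 2) := by rw [hb]; push_cast; field_simp
  have hb0 : 0 < b := by rw [hb']; positivity
  have hcont := continuous_thetaThreeCircle_sub hlam hp
  set E : ℝ → ℂ := fun x => thetaThreeCircle (Complex.I / lam) (x : UnitAddCircle) - p x with hE
  have hterm : ∀ (j : ℕ) (x : ℝ), 0 ≤ ‖E (x + j / (2 * N + 2))‖ -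
      ((-1 : ℂ) ^ j * E (x + j / (2 * N + 2))).re :=
    fun j x => sub_nonneg.2 (re_neg_one_pow_mul_le_norm _ _)
  -- By continuity the vanishing holds on the closed cell; the endpoints are what is used.
  have hzero : ∀ x ∈ Set.Icc (-b) b, ∀ j ∈ Finset.range (2 * N + 2),
      ‖E (x + j / (2 * N + 2))‖ - ((-1 : ℂ) ^ j * E (x + j / (2 * N + 2))).re = 0 := by
    intro x hx
    rw [← Finset.sum_eq_zero_iff_of_nonneg fun j _ => hterm j x]
    by_contra hne
    have hpos := intervalIntegral.integral_pos (a := -b) (b := b) (by linarith)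
      (f := fun x => ∑ j ∈ Finset.range (2 * N + 2), (‖E (x + j / (2 * N + 2))‖ -
        ((-1 : ℂ) ^ j * E (x + j / (2 * N + 2))).re))
      (by have := hcont; exact Continuous.continuousOn (by fun_prop))
      (fun x _ => Finset.sum_nonneg fun j _ => hterm j x)
      ⟨x, hx, lt_of_le_of_ne (Finset.sum_nonneg fun j _ => hterm j x) (Ne.symm hne)⟩
    exact hpos.ne' h
  rw [Finset.mem_range] at hi
  -- The node is the right end of cell i and the left end of cell i+1, so the norm of the error
  -- equals both its real part and minus that real part. The restriction i < 2N+1 keeps i+1 in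
  -- range.
  have h1 := hzero b ⟨by linarith, le_rfl⟩ i (Finset.mem_range.2 (by omega))
  have h2 := hzero (-b) ⟨le_rfl, by linarith⟩ (i + 1) (Finset.mem_range.2 (by omega))
  have e1 : b + i / (2 * N + 2) = (i + 1 / 2) / (2 * N + 2) := by rw [hb']; ring
  have e2 : -b + ((i + 1 : ℕ) : ℝ) / (2 * N + 2) = (i + 1 / 2) / (2 * N + 2) := by
    rw [hb']; push_cast; ring
  rw [e1] at h1
  rw [e2, pow_succ, mul_neg_one, neg_mul, Complex.neg_re] at h2
  have h3 : ‖E ((i + 1 / 2) / (2 * N + 2))‖ = 0 := by linarith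
  exact sub_eq_zero.1 (norm_eq_zero.1 h3)

/-- Two nodes differ by less than a full period. -/
theorem expTwoPi_nodes_injOn (N : ℕ) :
    Set.InjOn (fun i : ℕ => expTwoPi ((i + 1 / 2) / (2 * N + 2))) (Finset.range (2 * N + 1)) := by
  have hM : (2 * N + 2 : ℝ) ≠ 0 := by positivity
  intro i hi j hj hij
  simp only [Finset.coe_range, Set.mem_Iio] at hi hj
  have h : expTwoPi ((i + 1 / 2) / (2 * N + 2) - (j + 1 / 2) / (2 * N + 2)) = 1 := by
    rw [sub_eq_add_neg, expTwoPi_add, expTwoPi_neg]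
    simp only at hij
    rw [hij, mul_inv_cancel₀ (expTwoPi_ne_zero _)]
  obtain ⟨m, hm⟩ := (expTwoPi_eq_one_iff _).1 h
  have h1 : (i : ℤ) - j = m * (2 * N + 2) := by
    have : (i : ℝ) - j = m * (2 * N + 2) := by
      rw [← sub_div, div_eq_iff hM] at hm
      linarith
    exact_mod_cast this
  have hm0 : m = 0 := by
    rcases lt_trichotomy m 0 with h | h | h
    · have : m + 1 ≤ 0 := h
      nlinarith
    · exact h
    · have : 1 ≤ m := h
      nlinarith
  rw [hm0, zero_mul] at h1
  omega

theorem eq_kCircle_of_eq_at_nodes (hlam : 0 < lam) (hp : IsTrigPolyOfDegreeLE N p)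
    (h : ∀ i ∈ Finset.range (2 * N + 1),
      thetaThreeCircle (Complex.I / lam) (((i + 1 / 2) / (2 * N + 2) : ℝ) : UnitAddCircle) =
        p (((i + 1 / 2) / (2 * N + 2) : ℝ) : UnitAddCircle)) : p = kCircle lam N := by
  obtain ⟨c, hc⟩ := hp
  have hM : (2 * N + 2 : ℝ) ≠ 0 := by positivity
  have hdiff : ∀ x : ℝ, ∑ n ∈ Finset.Icc (-(N : ℤ)) N,
      (c n - aliasCoeff lam (N + 1) n) * expTwoPi (n * x) = p x - interpPoly lam N x := by
    intro x
    rw [hc, interpPoly, ← Finset.sum_sub_distrib]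
    exact Finset.sum_congr rfl fun n _ => by rw [fourier_eq_expTwoPi, sub_mul]
  have hz := trigPoly_eq_zero_of_zeros N (fun n => c n - aliasCoeff lam (N + 1) n)
    (fun i => (i + 1 / 2) / (2 * N + 2)) (expTwoPi_nodes_injOn N) fun i hi => by
      rw [hdiff, ← h i hi, thetaThreeCircle_coe,
        interpPoly_eq_thetaThree_of_node hlam N (m := i) (by push_cast; field_simp), sub_self]
  ext x
  induction x using QuotientAddGroup.induction_on with
  | H x =>
    rw [kCircle_coe hlam]
    have := hz x
    rw [hdiff] at this
    exact sub_eq_zero.1 this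

end Approximation

/-! ### Main theorem -/

theorem theorem5 (lam : ℝ) (hlam : 0 < lam) (N : ℕ) :
    IsTrigPolyOfDegreeLE N (kCircle lam N) ∧
    ∀ p : UnitAddCircle → ℂ, IsTrigPolyOfDegreeLE N p →
      (∫ u in (-(1 / 2) : ℝ)..(1 / 2), thetaOne (u : ℂ) (Complex.I * (2 * N + 2) ^ 2 / lam)) ≤
        ((∫ x : UnitAddCircle, ‖thetaThreeCircle (Complex.I / lam) x - p x‖ : ℝ) : ℂ) ∧
      ((∫ u in (-(1 / 2) : ℝ)..(1 / 2), thetaOne (u : ℂ) (Complex.I * (2 * N + 2) ^ 2 / lam)) =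
        ((∫ x : UnitAddCircle, ‖thetaThreeCircle (Complex.I / lam) x - p x‖ : ℝ) : ℂ) ↔
        p = kCircle lam N) := by
  refine ⟨isTrigPolyOfDegreeLE_kCircle hlam N, fun p hp => ?_⟩
  have hgap := integral_norm_sub_integral_eq hlam hp
  have hle : (-(1 / (2 * (2 * N + 2 : ℕ))) : ℝ) ≤ 1 / (2 * (2 * N + 2 : ℕ)) := by
    have : (0 : ℝ) ≤ 1 / (2 * (2 * N + 2 : ℕ)) := by positivity
    linarith
  -- Both sides are now casts of real numbers, so the order and equality in ℂ become those in ℝ.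
  rw [integral_thetaOne_eq hlam, Complex.real_le_real, Complex.ofReal_inj]
  refine ⟨?_, fun heq => ?_, ?_⟩
  · rw [← sub_nonneg, hgap]
    exact intervalIntegral.integral_nonneg hle fun x _ => Finset.sum_nonneg fun i _ =>
      sub_nonneg.2 (re_neg_one_pow_mul_le_norm _ _)
  · rw [heq, sub_self] at hgap
    exact eq_kCircle_of_eq_at_nodes hlam hp fun i hi =>
      eq_at_nodes_of_integral_eq_zero hlam hp hgap.symm hi
  · rintro rfl
    refine (sub_eq_zero.1 (hgap.trans ?_)).symm
    refine (intervalIntegral.integral_congr fun x hx => ?_).trans intervalIntegral.integral_zero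
    refine Finset.sum_eq_zero fun i _ => sub_eq_zero.2 (norm_error_kCircle hlam i ?_)
    rw [Set.uIcc_of_le hle] at hx
    exact abs_le.2 (by exact_mod_cast hx)
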